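/- For integers $m,n\ge 3$ let $R_{2,m}\subset\mathbb R^{2\times m}$ be the set of real $2\times m$ matrices $M$ whose columns are in convex position and affinely span $\mathbb R^2$, and let $P(M)\subset\mathbb R^2$ be the convex hull of the columns of $M$ (an $m$-gon). Let $R'_{2,n}\subset\mathbb R^{n\times 2}$ be the set of real $n\times 2$ matrices $M'$ for which $Q(M')=\{x\in\mathbb R^2 : M'x\le \mathbf 1\}$ (coordinatewise inequality, $\mathbf 1=(1,\dots,1)$) is a $2$-dimensional polytope with exactly $n$ facets (an $n$-gon). For such $M,M'$ let $\mathrm{Hom}(P(M),Q(M'))$ be the polytope of all affine maps $f:\mathbb R^2\to\mathbb R^2$ with $f(P(M))\subset Q(M')$, viewed in the $6$-dimensional vector space of affine maps $\mathbb R^2\to\mathbb R^2$. A vertex of a $d$-dimensional polytope is called simple if it lies in exactly $d$ facets. There are dense open subsets $V_{m,n}$ of $R_{2,m}\times R'_{2,n}$ (for all $m,n\ge3$) with the following property: for every $m\ge 3$ and every $\varepsilon>0$ there is an $N$ such that for all $n\ge \max(N,3)$ and all $(M,M')\in V_{m,n}$, $$\left|\frac{\#\{\text{simple vertices of }\mathrm{Hom}(P(M),Q(M'))\}}{\#\{\text{vertices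 of }\mathrm{Hom}(P(M),Q(M'))\}}-1\right|<\varepsilon .$$ That is, for fixed $m$ the proportion of simple vertices tends to $1$ as $n\to\infty$, uniformly over $(M,M')\in V_{m,n}$. -/

import Mathlib

open Set

namespace HomPolytope

/-- The dimension of a nonempty convex subset `X` of a finite-dimensional real vector space:
the dimension of the linear space parallel to its affine hull. -/
noncomputable def dim {E : Type*} [AddCommGroup E] [Module ℝ E] (X : Set E) : ℕ :=
  Module.finrank ℝ (vectorSpan ℝ X)

/-- `F` is a nonempty face of the polytope `X`: the (nonempty) set of points of `X` at which some
linear functional attains its maximum over `X`. -/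
def IsFace {E : Type*} [AddCommGroup E] [Module ℝ E] (X F : Set E) : Prop :=
  F.Nonempty ∧ ∃ l : E →ₗ[ℝ] ℝ, F = {x ∈ X | ∀ y ∈ X, l y ≤ l x}

/-- The set of facets of a polytope `X`: the nonempty faces of dimension `dim X - 1`. -/
def facets {E : Type*} [AddCommGroup E] [Module ℝ E] (X : Set E) : Set (Set E) :=
  {F | IsFace X F ∧ dim F + 1 = dim X}

/-- The set of vertices of a polytope `X`. -/
def vertices {E : Type*} [AddCommGroup E] [Module ℝ E] (X : Set E) : Set E :=
  X.extremePoints ℝ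

/-- The set of simple vertices of a polytope `X`: the vertices that lie in exactly `dim X`
facets. -/
def simpleVertices {E : Type*} [AddCommGroup E] [Module ℝ E] (X : Set E) : Set E :=
  {v ∈ vertices X | {F ∈ facets X | v ∈ F}.encard = dim X}

/-- The polytope `P(M)` in `ℝ^d`: the convex hull of the columns of `M`. -/
def colPolytope {d m : ℕ} (M : Matrix (Fin d) (Fin m) ℝ) : Set (Fin d → ℝ) :=
  convexHull ℝ (range fun j i => M i j)

/-- The polyhedron `Q(M')` in `ℝ^e`: the set of solutions of `M' x ≤ 1` (coordinatewise). -/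
def rowPolyhedron {e n : ℕ} (M' : Matrix (Fin n) (Fin e) ℝ) : Set (Fin e → ℝ) :=
  {x | ∀ i, M'.mulVec x i ≤ 1}

/-- `R_{d,m}`: the `d × m` matrices whose columns are in convex position and affinely
span `ℝ^d`. -/
def colRealizations (d m : ℕ) : Set (Matrix (Fin d) (Fin m) ℝ) :=
  {M | ConvexIndependent ℝ (fun (j : Fin m) (i : Fin d) => M i j) ∧
    affineSpan ℝ (range fun (j : Fin m) (i : Fin d) => M i j) = ⊤}

/-- `R'_{e,n}`: the `n × e` matrices `M'` for which the polyhedron `Q(M')` is an `e`-polytope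
(compact of dimension `e`) with `n` facets. -/
def rowRealizations (e n : ℕ) : Set (Matrix (Fin n) (Fin e) ℝ) :=
  {M' | IsCompact (rowPolyhedron M') ∧ dim (rowPolyhedron M') = e ∧
    (facets (rowPolyhedron M')).encard = n}

/-- The hom-polytope `Hom(P, Q)` of affine maps `P → Q`, as a subset of the vector space of affine
maps `E → E'`. It is meant for `P` with affine hull `E`, when an affine map on `P` is the
restriction of exactly one affine map on `E`. -/
def homPolytope {E E' : Type*} [AddCommGroup E] [Module ℝ E] [AddCommGroup E'] [Module ℝ E']
    (P : Set E) (Q : Set E') : Set (E →ᵃ[ℝ] E') :=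
  {f | MapsTo f P Q}

/-- The proportion of simple vertices among all vertices of a polytope `X`. -/
noncomputable def simpleRatio {E : Type*} [AddCommGroup E] [Module ℝ E] (X : Set E) : ℝ :=
  ((simpleVertices X).ncard : ℝ) / ((vertices X).ncard : ℝ)

end HomPolytope

/-! `Hom(P, Q)` is cut out of a 6-dimensional space by the inequalities `a_i ⬝ᵥ f p_j ≤ 1`, with
`p_j` the columns of `M` and `a_i` the rows of `M'`. A vertex `f` with exactly six tight pairs `(i,
j)` is simple, so a non-simple one has at least seven. The proof shows that non-simple vertices
number `O(n)` and simple ones at least a constant times `n ^ 2`, for fixed `m`.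

Upper bound. If `f` is injective, seven tight pairs are an algebraic coincidence: moving one column
breaks it, so a determinant in `(M, M')` is not identically zero and general position excludes it
(`not_injective_of_seven_le`). If `f` is not injective, it maps `P` onto a segment or a point, and
unless the image lies in one edge line of `Q` at most six pairs are tight
(`exists_line_of_not_injective`). Vertices mapping `P` into an edge line are determined by
recording, for each column, which of at most three tight sets occurs there; there are at most `n * 3
^ m` of them (`ncard_vertices_into_line_le`).

Lower bound. Project `P` along one of its edges onto a segment, so that a single vertex lies
farthest from that edge, and map this segment onto one joining two vertices of `Q` that share no
edge. Exactly `2 * 2 + 2 = 6` pairs are tight, and the map is a simple vertex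
(`ncard_disjointPairs_le`). There are quadratically many such pairs of vertices. -/

namespace HomPolytope

/-! ### Faces, facets and vertices of polyhedra given by inequalities. -/

section Polyhedra

variable {E K : Type*} [AddCommGroup E] [Module ℝ E]

/-- The polyhedron cut out by the inequalities `l k x ≤ b k`. -/
def polyhedron (l : K → E →ₗ[ℝ] ℝ) (b : K → ℝ) : Set E := {x | ∀ k, l k x ≤ b k}

/-- The face of a polyhedron on which the inequality `k` is tight. -/
def tightFace (l : K → E →ₗ[ℝ] ℝ) (b : K → ℝ) (k : K) : Set E :=
  {x ∈ polyhedron l b | l k x = b k}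

variable {l : K → E →ₗ[ℝ] ℝ} {b : K → ℝ}

lemma convex_polyhedron : Convex ℝ (polyhedron l b) := by
  intro x hx y hy s t hs ht hst k
  have h1 := mul_le_mul_of_nonneg_left (hx k) hs
  have h2 := mul_le_mul_of_nonneg_left (hy k) ht
  have : s * b k + t * b k = b k := by rw [← add_mul, hst, one_mul]
  simp only [map_add, map_smul, smul_eq_mul]
  linarith

lemma exists_small_step [Finite K] (x v : E) :
    ∃ t : ℝ, 0 < t ∧ ∀ k, l k x < b k → l k (x + t • v) < b k ∧ l k (x - t • v) < b k := by
  have h : ∀ᶠ t : ℝ in nhdsWithin 0 (Ioi 0),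
      ∀ k, l k x < b k → l k (x + t • v) < b k ∧ l k (x - t • v) < b k := by
    rw [Filter.eventually_all]
    intro k
    by_cases hk : l k x < b k
    · have h1 : Filter.Tendsto (fun t : ℝ => l k x + t * l k v) (nhdsWithin 0 (Ioi 0))
          (nhds (l k x + 0 * l k v)) :=
        (Continuous.tendsto (by fun_prop) 0).mono_left nhdsWithin_le_nhds
      have h2 : Filter.Tendsto (fun t : ℝ => l k x - t * l k v) (nhdsWithin 0 (Ioi 0))
          (nhds (l k x - 0 * l k v)) :=
        (Continuous.tendsto (by fun_prop) 0).mono_left nhdsWithin_le_nhds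
      filter_upwards [h1.eventually_lt_const (by simpa using hk),
        h2.eventually_lt_const (by simpa using hk)] with t ht1 ht2 _
      simp only [map_add, map_sub, map_smul, smul_eq_mul]
      exact ⟨ht1, ht2⟩
    · exact Filter.Eventually.of_forall fun t h => absurd h hk
  obtain ⟨t, ht, h0⟩ := (h.and self_mem_nhdsWithin).exists
  exact ⟨t, h0, ht⟩

/-- The midpoint of two points of `C` is strict wherever either of them is, so strictness
accumulates one index at a time. -/
lemma exists_forall_lt {C : Set E} (hC : Convex ℝ C) (hne : C.Nonempty)
    (hle : ∀ x ∈ C, ∀ k, l k x ≤ b k) (s : Finset K)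
    (h : ∀ k ∈ s, ∃ x ∈ C, l k x < b k) : ∃ x ∈ C, ∀ k ∈ s, l k x < b k := by
  classical
  induction s using Finset.induction_on with
  | empty => exact ⟨hne.some, hne.some_mem, by simp⟩
  | insert k s hk ih =>
    obtain ⟨x, hx, hxs⟩ := ih fun k' hk' => h k' (Finset.mem_insert_of_mem hk')
    obtain ⟨y, hy, hyk⟩ := h k (Finset.mem_insert_self k s)
    refine ⟨(1 / 2 : ℝ) • x + (1 / 2 : ℝ) • y,
      hC hx hy (by norm_num) (by norm_num) (by norm_num), fun k' hk' => ?_⟩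
    have h1 := hle x hx k'
    have h2 := hle y hy k'
    simp only [map_add, map_smul, smul_eq_mul]
    rcases Finset.mem_insert.1 hk' with rfl | hk'
    · linarith
    · have := hxs k' hk'
      linarith

lemma sub_mem_vectorSpan {X : Set E} {x v : E} {t : ℝ} (ht : 0 < t) (hx : x ∈ X)
    (h : x + t • v ∈ X) : v ∈ vectorSpan ℝ X := by
  have h1 : (x + t • v) - x ∈ vectorSpan ℝ X := vsub_mem_vectorSpan ℝ h hx
  rw [add_sub_cancel_left] at h1
  have := Submodule.smul_mem _ t⁻¹ h1
  rwa [smul_smul, inv_mul_cancel₀ ht.ne', one_smul] at this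

lemma vectorSpan_le_ker {X : Set E} {g : E →ₗ[ℝ] ℝ} {c : ℝ} (h : ∀ x ∈ X, g x = c) :
    vectorSpan ℝ X ≤ LinearMap.ker g := by
  rw [vectorSpan_def, Submodule.span_le]
  rintro _ ⟨x, hx, y, hy, rfl⟩
  simp [h x hx, h y hy]

lemma vectorSpan_polyhedron [Finite K] {x₀ : E} (h₀ : ∀ k, l k x₀ < b k) :
    vectorSpan ℝ (polyhedron l b) = ⊤ := by
  refine eq_top_iff.2 fun v _ => ?_
  obtain ⟨t, ht, h⟩ := exists_small_step (l := l) (b := b) x₀ v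
  exact sub_mem_vectorSpan ht (fun k => (h₀ k).le) fun k => (h k (h₀ k)).1.le

lemma dim_polyhedron [Finite K] {x₀ : E} (h₀ : ∀ k, l k x₀ < b k) :
    dim (polyhedron l b) = Module.finrank ℝ E := by
  rw [dim, vectorSpan_polyhedron h₀, finrank_top]

lemma finrank_ker_add_one [FiniteDimensional ℝ E] {g : E →ₗ[ℝ] ℝ} (hg : g ≠ 0) :
    Module.finrank ℝ (LinearMap.ker g) + 1 = Module.finrank ℝ E :=
  Module.Dual.finrank_ker_add_one_of_ne_zero hg

lemma vectorSpan_tightFace [Finite K] {k : K} {x : E} (hk : l k x = b k)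
    (hx : ∀ k', k' ≠ k → l k' x < b k') :
    vectorSpan ℝ (tightFace l b k) = LinearMap.ker (l k) := by
  refine le_antisymm (vectorSpan_le_ker fun y hy => hy.2) fun v hv => ?_
  obtain ⟨t, ht, h⟩ := exists_small_step (l := l) (b := b) x v
  have hv' : l k v = 0 := hv
  have hxk : l k (x + t • v) = b k := by simp [hv', hk]
  have hmem : ∀ y : E, l k y = b k → (∀ k', k' ≠ k → l k' y < b k') → y ∈ tightFace l b k := by
    refine fun y hy hy' => ⟨fun k' => ?_, hy⟩
    by_cases hkk : k' = k
    · rw [hkk, hy]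
    · exact (hy' k' hkk).le
  exact sub_mem_vectorSpan ht (hmem x hk hx) (hmem _ hxk fun k' hk' => (h k' (hx k' hk')).1)

lemma isFace_tightFace {k : K} {x : E} (hx : x ∈ tightFace l b k) :
    IsFace (polyhedron l b) (tightFace l b k) := by
  refine ⟨⟨x, hx⟩, l k, ?_⟩
  ext y
  constructor
  · rintro ⟨hy, hyk⟩
    exact ⟨hy, fun z hz => hyk ▸ hz k⟩
  · rintro ⟨hy, h⟩
    exact ⟨hy, le_antisymm (hy k) (hx.2 ▸ h x hx.1)⟩

lemma tightFace_mem_facets [FiniteDimensional ℝ E] [Finite K] {x₀ : E} (h₀ : ∀ k, l k x₀ < b k)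
    {k : K} {x : E} (hk : l k x = b k) (hx : ∀ k', k' ≠ k → l k' x < b k') :
    tightFace l b k ∈ facets (polyhedron l b) := by
  have hne : l k ≠ 0 := by
    intro h
    have h1 := h₀ k
    rw [← hk, h] at h1
    simp at h1
  refine ⟨isFace_tightFace (x := x) ⟨fun k' => ?_, hk⟩, ?_⟩
  · by_cases hkk : k' = k
    · rw [hkk, hk]
    · exact (hx k' hkk).le
  · rw [dim_polyhedron h₀, dim, vectorSpan_tightFace hk hx, finrank_ker_add_one hne]

/-- Every facet of a polyhedron is the face on which one of the inequalities is tight. -/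
lemma exists_eq_tightFace [FiniteDimensional ℝ E] [Finite K] {x₀ : E} (h₀ : ∀ k, l k x₀ < b k)
    {F : Set E} (hF : F ∈ facets (polyhedron l b)) : ∃ k, F = tightFace l b k := by
  classical
  have := Fintype.ofFinite K
  obtain ⟨⟨⟨y, hyF⟩, g, rfl⟩, hdim⟩ := hF
  set F : Set E := {x ∈ polyhedron l b | ∀ y ∈ polyhedron l b, g y ≤ g x} with hFdef
  have hconv : Convex ℝ F := by
    intro x hx z hz s t hs ht hst
    refine ⟨convex_polyhedron hx.1 hz.1 hs ht hst, fun w hw => ?_⟩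
    have h1 := mul_le_mul_of_nonneg_left (hx.2 w hw) hs
    have h2 := mul_le_mul_of_nonneg_left (hz.2 w hw) ht
    have : s * g w + t * g w = g w := by rw [← add_mul, hst, one_mul]
    simp only [map_add, map_smul, smul_eq_mul]
    linarith
  have hconst : ∀ x ∈ F, g x = g y := fun x hx => le_antisymm (hyF.2 x hx.1) (hx.2 y hyF.1)
  -- If no inequality is tight on all of `F`, some point of `F` is interior; a functional maximal
  -- there vanishes, so `F` would be the whole polyhedron, of the wrong dimension.
  by_cases hall : ∀ k, ∃ x ∈ F, l k x < b k
  · exfalso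
    obtain ⟨x, hxF, hx⟩ := exists_forall_lt (l := l) (b := b) hconv ⟨y, hyF⟩
      (fun x hx => hx.1) Finset.univ fun k _ => hall k
    have hg : g = 0 := by
      ext v
      obtain ⟨t, ht, h⟩ := exists_small_step (l := l) (b := b) x v
      have h1 := hxF.2 (x + t • v) fun k => (h k (hx k (Finset.mem_univ k))).1.le
      have h2 := hxF.2 (x - t • v) fun k => (h k (hx k (Finset.mem_univ k))).2.le
      simp only [map_add, map_sub, map_smul, smul_eq_mul] at h1 h2
      have : t * g v = 0 := by linarith
      simpa [ht.ne'] using this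
    have : F = polyhedron l b := by
      rw [hFdef, hg]
      ext z
      simp
    rw [this] at hdim
    omega
  · push Not at hall
    obtain ⟨k, hk⟩ := hall
    refine ⟨k, ?_⟩
    have hFk : ∀ x ∈ F, l k x = b k := fun x hx => le_antisymm (hx.1 k) (hk x hx)
    have hne : l k ≠ 0 := by
      intro h
      have h1 := h₀ k
      rw [← hFk y hyF, h] at h1
      simp at h1
    have hker : vectorSpan ℝ F = LinearMap.ker (l k) := by
      apply Submodule.eq_of_le_of_finrank_eq (vectorSpan_le_ker hFk)
      have h1 := finrank_ker_add_one hne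
      rw [dim_polyhedron h₀, dim] at hdim
      omega
    refine Subset.antisymm (fun x hx => ⟨hx.1, hFk x hx⟩) fun x hx => ⟨hx.1, fun z hz => ?_⟩
    -- `g` is constant on `F`, hence along `ker (l k)`, so every point tight at `k` maximises `g`
    -- too.
    have hxy : x - y ∈ vectorSpan ℝ F := by
      rw [hker, LinearMap.mem_ker, map_sub, hx.2, hFk y hyF, sub_self]
    have := vectorSpan_le_ker hconst hxy
    rw [LinearMap.mem_ker, map_sub, sub_eq_zero] at this
    rw [this]
    exact hyF.2 z hz

/-- A direction killed by all tight functionals can be followed both ways from `x`; conversely, an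
inequality tight inside a segment is tight at both ends. -/
lemma mem_extremePoints_polyhedron [Finite K] {x : E} :
    x ∈ (polyhedron l b).extremePoints ℝ ↔
      x ∈ polyhedron l b ∧ ∀ v, (∀ k, l k x = b k → l k v = 0) → v = 0 := by
  constructor
  · rintro ⟨hx, hext⟩
    refine ⟨hx, fun v hv => ?_⟩
    obtain ⟨t, ht, h⟩ := exists_small_step (l := l) (b := b) x v
    have h1 : x + t • v ∈ polyhedron l b := fun k => by
      rcases (hx k).lt_or_eq with hlt | heq
      · exact (h k hlt).1.le
      · simp [hv k heq, heq]
    have h2 : x - t • v ∈ polyhedron l b := fun k => by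
      rcases (hx k).lt_or_eq with hlt | heq
      · exact (h k hlt).2.le
      · simp [hv k heq, heq]
    have h3 : x ∈ openSegment ℝ (x + t • v) (x - t • v) := by
      refine ⟨1 / 2, 1 / 2, by norm_num, by norm_num, by norm_num, ?_⟩
      module
    have h4 := hext h1 h2 h3
    rw [add_eq_left] at h4
    exact (smul_eq_zero.1 h4).resolve_left ht.ne'
  · rintro ⟨hx, h⟩
    refine ⟨hx, ?_⟩
    rintro y hy z hz ⟨s, t, hs, ht, hst, rfl⟩
    have hyz : y - z = 0 := by
      refine h _ fun k hk => ?_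
      simp only [map_add, map_smul, smul_eq_mul] at hk
      have h1 := mul_le_mul_of_nonneg_left (hy k) hs.le
      have h2 := mul_le_mul_of_nonneg_left (hz k) ht.le
      have h3 : s * b k + t * b k = b k := by rw [← add_mul, hst, one_mul]
      have h4 : l k y = b k := mul_left_cancel₀ hs.ne' (by linarith)
      have h5 : l k z = b k := mul_left_cancel₀ ht.ne' (by linarith)
      rw [map_sub, h4, h5, sub_self]
    rw [sub_eq_zero] at hyz
    rw [hyz, ← add_smul, hst, one_smul]

lemma finite_extremePoints_polyhedron [Finite K] :
    ((polyhedron l b).extremePoints ℝ).Finite := by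
  refine Set.Finite.of_injOn (f := fun x => {k | l k x = b k}) (t := univ)
    (fun _ _ => mem_univ _) ?_ Set.finite_univ
  intro x hx y hy hxy
  have hxy : ∀ k, l k x = b k ↔ l k y = b k := fun k => Set.ext_iff.1 hxy k
  have := (mem_extremePoints_polyhedron.1 hx).2 (x - y) fun k hk => by
    rw [map_sub, hk, (hxy k).1 hk, sub_self]
  exact sub_eq_zero.1 this

/-- A vertex at which exactly `finrank ℝ E` inequalities are tight is simple. -/
lemma mem_simpleVertices_of_ncard [FiniteDimensional ℝ E] [Finite K] {x₀ : E}
    (h₀ : ∀ k, l k x₀ < b k) {x : E} (hx : x ∈ vertices (polyhedron l b))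
    (hcard : {k | l k x = b k}.ncard = Module.finrank ℝ E) :
    x ∈ simpleVertices (polyhedron l b) := by
  classical
  have := Fintype.ofFinite K
  refine ⟨hx, ?_⟩
  obtain ⟨hxX, hsep⟩ := mem_extremePoints_polyhedron.1 hx
  set T : Set K := {k | l k x = b k} with hT
  let ev : E →ₗ[ℝ] (T → ℝ) := LinearMap.pi fun k => l k
  have hinj : Function.Injective ev := by
    rw [← LinearMap.ker_eq_bot, LinearMap.ker_eq_bot']
    intro v hv
    exact hsep v fun k hk => congrFun hv ⟨k, hk⟩
  have hfin : Module.finrank ℝ E = Module.finrank ℝ (T → ℝ) := by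
    rw [Module.finrank_fintype_fun_eq_card, ← hcard, Set.ncard_eq_toFinset_card', Set.toFinset_card]
  have hsurj := (LinearMap.injective_iff_surjective_of_finrank_eq_finrank hfin).1 hinj
  have hwit : ∀ k ∈ T, ∃ y, l k y = b k ∧ ∀ k', k' ≠ k → l k' y < b k' := by
    intro k hk
    -- The tight functionals form a basis of the dual, so a direction can stay on facet `k` while
    -- leaving all the other tight ones.
    obtain ⟨v, hv⟩ := hsurj fun k' => if k' = ⟨k, hk⟩ then 0 else -1
    obtain ⟨t, ht, h⟩ := exists_small_step (l := l) (b := b) x v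
    have hk' : l k x = b k := hk
    have hv0 : l k v = 0 := by simpa [ev] using congrFun hv ⟨k, hk⟩
    refine ⟨x + t • v, by simp [hk', hv0], fun k' hk'k => ?_⟩
    by_cases hk'T : k' ∈ T
    · have hv1 : l k' v = -1 := by simpa [ev, hk'k] using congrFun hv ⟨k', hk'T⟩
      have : l k' x = b k' := hk'T
      simp only [map_add, map_smul, smul_eq_mul, hv1, this]
      linarith
    · exact (h k' ((hxX k').lt_of_ne hk'T)).1
  have himg : {F ∈ facets (polyhedron l b) | x ∈ F} = tightFace l b '' T := by
    ext F
    constructor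
    · rintro ⟨hF, hxF⟩
      obtain ⟨k, rfl⟩ := exists_eq_tightFace h₀ hF
      exact ⟨k, hxF.2, rfl⟩
    · rintro ⟨k, hk, rfl⟩
      obtain ⟨y, hy, hy'⟩ := hwit k hk
      exact ⟨tightFace_mem_facets h₀ hy hy', hxX, hk⟩
  have hinjOn : InjOn (tightFace l b) T := by
    intro k hk k' hk' heq
    by_contra hne
    obtain ⟨y, hy, hy'⟩ := hwit k hk
    have hmem : y ∈ tightFace l b k := by
      refine ⟨fun j => ?_, hy⟩
      by_cases hj : j = k
      · rw [hj, hy]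
      · exact (hy' j hj).le
    rw [heq] at hmem
    exact (hy' k' (Ne.symm hne)).ne hmem.2
  rw [himg, hinjOn.encard_image, dim_polyhedron h₀, ← hcard, (Set.toFinite T).cast_ncard_eq]

lemma finrank_le_ncard_tight [FiniteDimensional ℝ E] [Finite K] {x : E}
    (hx : x ∈ vertices (polyhedron l b)) :
    Module.finrank ℝ E ≤ {k | l k x = b k}.ncard := by
  classical
  have := Fintype.ofFinite K
  obtain ⟨hxX, hsep⟩ := mem_extremePoints_polyhedron.1 hx
  let ev : E →ₗ[ℝ] ({k | l k x = b k} → ℝ) := LinearMap.pi fun k => l k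
  have hinj : Function.Injective ev := by
    rw [← LinearMap.ker_eq_bot, LinearMap.ker_eq_bot']
    intro v hv
    exact hsep v fun k hk => congrFun hv ⟨k, hk⟩
  have := LinearMap.finrank_le_finrank_of_injective hinj
  rwa [Module.finrank_fintype_fun_eq_card, ← Set.toFinset_card,
    ← Set.ncard_eq_toFinset_card'] at this

/-- If a polyhedron has as many facets as inequalities, then each inequality is tight at a point
where all the others are strict. -/
lemma exists_witness_of_encard_facets [FiniteDimensional ℝ E] [Fintype K] {x₀ : E}
    (h₀ : ∀ k, l k x₀ < b k) (hcard : (facets (polyhedron l b)).encard = Fintype.card K) (k : K) :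
    ∃ x, l k x = b k ∧ ∀ k', k' ≠ k → l k' x < b k' := by
  classical
  have hsub : facets (polyhedron l b) ⊆ range (tightFace l b) := by
    intro F hF
    obtain ⟨k, rfl⟩ := exists_eq_tightFace h₀ hF
    exact ⟨k, rfl⟩
  have huniv : (univ : Set K).encard = Fintype.card K := by simp
  have hle : (range (tightFace l b)).encard ≤ Fintype.card K := by
    rw [← image_univ, ← huniv]
    exact encard_image_le _ _
  -- Facets are among the tight faces, so equality of counts makes every tight face a facet and
  -- `tightFace` injective.
  have hfac : facets (polyhedron l b) = range (tightFace l b) :=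
    ((finite_range _).subset hsub).eq_of_subset_of_encard_le hsub (hcard ▸ hle)
  have hinj : Function.Injective (tightFace l b) := by
    rw [← injOn_univ]
    apply (finite_univ).injOn_of_encard_image_eq
    rw [image_univ, ← hfac, hcard, huniv]
  have hkF : ∀ k, tightFace l b k ∈ facets (polyhedron l b) := fun k => hfac ▸ mem_range_self k
  have hne0 : ∀ k, l k ≠ 0 := by
    intro k h
    obtain ⟨y, hy⟩ := (hkF k).1.1
    have h1 := h₀ k
    rw [← hy.2, h] at h1
    simp at h1
  have hker : ∀ k, vectorSpan ℝ (tightFace l b k) = LinearMap.ker (l k) := by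
    intro k
    apply Submodule.eq_of_le_of_finrank_eq (vectorSpan_le_ker fun y hy => hy.2)
    have h1 := finrank_ker_add_one (hne0 k)
    have h2 := (hkF k).2
    rw [dim_polyhedron h₀, dim] at h2
    omega
  have hconv : Convex ℝ (tightFace l b k) := by
    intro x hx z hz s t hs ht hst
    refine ⟨convex_polyhedron hx.1 hz.1 hs ht hst, ?_⟩
    simp only [map_add, map_smul, smul_eq_mul, hx.2, hz.2]
    rw [← add_mul, hst, one_mul]
  obtain ⟨x, hx, hlt⟩ := exists_forall_lt (l := l) (b := b) hconv (hkF k).1.1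
    (fun x hx => hx.1) (Finset.univ.erase k) fun k' hk' => by
      -- An inequality `k'` tight on all of facet `k` has the same kernel, hence the same tight
      -- face, against injectivity.
      by_contra! hcon
      have hk'' := Finset.ne_of_mem_erase hk'
      apply hk''
      apply hinj
      obtain ⟨y, hy⟩ := (hkF k).1.1
      have hall : ∀ z ∈ tightFace l b k, l k' z = b k' :=
        fun z hz => le_antisymm (hz.1 k') (hcon z hz)
      have hkk : LinearMap.ker (l k) = LinearMap.ker (l k') := by
        apply Submodule.eq_of_le_of_finrank_eq
        · rw [← hker k]
          exact vectorSpan_le_ker hall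
        · have h1 := finrank_ker_add_one (hne0 k)
          have h2 := finrank_ker_add_one (hne0 k')
          omega
      refine Subset.antisymm (fun z hz => ⟨hz.1, ?_⟩) fun z hz => ⟨hz.1, hall z hz⟩
      have hmem : z - y ∈ LinearMap.ker (l k) := by
        rw [hkk, LinearMap.mem_ker, map_sub, hz.2, hall y hy, sub_self]
      rw [LinearMap.mem_ker, map_sub, hy.2, sub_eq_zero] at hmem
      exact hmem
  exact ⟨x, hx.2, fun k' hk' => hlt k' (by simpa using hk')⟩

lemma encard_facets_of_witness [FiniteDimensional ℝ E] [Fintype K] {x₀ : E}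
    (h₀ : ∀ k, l k x₀ < b k)
    (hwit : ∀ k, ∃ x, l k x = b k ∧ ∀ k', k' ≠ k → l k' x < b k') :
    (facets (polyhedron l b)).encard = Fintype.card K := by
  have himg : facets (polyhedron l b) = range (tightFace l b) := by
    refine Subset.antisymm (fun F hF => ?_) ?_
    · obtain ⟨k, rfl⟩ := exists_eq_tightFace h₀ hF
      exact ⟨k, rfl⟩
    · rintro _ ⟨k, rfl⟩
      obtain ⟨x, hx, hx'⟩ := hwit k
      exact tightFace_mem_facets h₀ hx hx'
  have hinj : Function.Injective (tightFace l b) := by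
    intro k k' heq
    by_contra hne
    obtain ⟨y, hy, hy'⟩ := hwit k
    have hmem : y ∈ tightFace l b k := by
      refine ⟨fun j => ?_, hy⟩
      by_cases hj : j = k
      · rw [hj, hy]
      · exact (hy' j hj).le
    rw [heq] at hmem
    exact (hy' k' (Ne.symm hne)).ne hmem.2
  rw [himg, ← image_univ, hinj.encard_image]
  simp

end Polyhedra

/-! ### Density of polynomial non-vanishing conditions. -/

/-- The points at which no function of the family `D` vanishes, except those that vanish
identically. -/
def genericSet {Z σ : Type*} (D : σ → Z → ℝ) : Set Z :=
  {z | ∀ s, (∃ z', D s z' ≠ 0) → D s z ≠ 0}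

section Generic

variable {Z : Type*} [AddCommGroup Z] [Module ℝ Z]

/-- The function `D` restricts to a polynomial function on every line. -/
def PolynomialOnLines (D : Z → ℝ) : Prop :=
  ∀ x v, ∃ p : Polynomial ℝ, ∀ t : ℝ, D (x + t • v) = p.eval t

namespace PolynomialOnLines

lemma const (c : ℝ) : PolynomialOnLines fun _ : Z => c :=
  fun _ _ => ⟨Polynomial.C c, by simp⟩

lemma linear (g : Z →ₗ[ℝ] ℝ) : PolynomialOnLines g :=
  fun x v => ⟨Polynomial.C (g x) + Polynomial.X * Polynomial.C (g v), fun t => by simp; ring⟩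

lemma add {D D' : Z → ℝ} (h : PolynomialOnLines D) (h' : PolynomialOnLines D') :
    PolynomialOnLines fun z => D z + D' z := by
  intro x v
  obtain ⟨p, hp⟩ := h x v
  obtain ⟨q, hq⟩ := h' x v
  exact ⟨p + q, by simp [hp, hq]⟩

lemma sub {D D' : Z → ℝ} (h : PolynomialOnLines D) (h' : PolynomialOnLines D') :
    PolynomialOnLines fun z => D z - D' z := by
  intro x v
  obtain ⟨p, hp⟩ := h x v
  obtain ⟨q, hq⟩ := h' x v
  exact ⟨p - q, by simp [hp, hq]⟩

lemma mul {D D' : Z → ℝ} (h : PolynomialOnLines D) (h' : PolynomialOnLines D') :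
    PolynomialOnLines fun z => D z * D' z := by
  intro x v
  obtain ⟨p, hp⟩ := h x v
  obtain ⟨q, hq⟩ := h' x v
  exact ⟨p * q, by simp [hp, hq]⟩

lemma det {ι : Type*} [Fintype ι] [DecidableEq ι] {A : Z → Matrix ι ι ℝ}
    (h : ∀ i j, PolynomialOnLines fun z => A z i j) : PolynomialOnLines fun z => (A z).det := by
  intro x v
  choose p hp using fun i j => h i j x v
  refine ⟨(Matrix.of p).det, fun t => ?_⟩
  rw [← Polynomial.coe_evalRingHom, RingHom.map_det]
  refine congrArg Matrix.det (Matrix.ext fun i j => ?_)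
  simp [hp]

end PolynomialOnLines

variable [TopologicalSpace Z]

/-- On the line from any `z` to `z'`, `D` is a nonzero polynomial with finitely many roots, so `z`
is a limit of non-zeros. -/
lemma PolynomialOnLines.dense [ContinuousAdd Z] [ContinuousSMul ℝ Z] {D : Z → ℝ}
    (h : PolynomialOnLines D) {z' : Z} (hz' : D z' ≠ 0) : Dense {z | D z ≠ 0} := by
  intro z
  obtain ⟨p, hp⟩ := h z (z' - z)
  have hp0 : p ≠ 0 := by
    rintro rfl
    have := hp 1
    simp at this
    exact hz' this
  have hfin : {t : ℝ | p.eval t = 0}.Finite := by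
    refine (p.roots.toFinset.finite_toSet).subset fun t ht => ?_
    simpa [hp0] using ht
  have hdense : Dense {t : ℝ | p.eval t = 0}ᶜ := hfin.countable.dense_compl ℝ
  have hc : Continuous fun t : ℝ => z + t • (z' - z) := by fun_prop
  have h0 := hc.continuousWithinAt.mem_closure_image (hdense 0)
  rw [zero_smul, add_zero] at h0
  refine closure_mono ?_ h0
  rintro _ ⟨t, ht, rfl⟩
  simpa [hp] using ht

lemma dense_genericSet [ContinuousAdd Z] [ContinuousSMul ℝ Z] {σ : Type*} [Finite σ]
    {D : σ → Z → ℝ} (hD : ∀ s, Continuous (D s)) (hp : ∀ s, PolynomialOnLines (D s)) :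
    Dense (genericSet D) := by
  classical
  have := Fintype.ofFinite σ
  -- Openness is carried along because dense sets intersect densely only when one of them is open.
  have key : ∀ S : Finset σ,
      IsOpen {z | ∀ s ∈ S, (∃ z', D s z' ≠ 0) → D s z ≠ 0} ∧
      Dense {z | ∀ s ∈ S, (∃ z', D s z' ≠ 0) → D s z ≠ 0} := by
    intro S
    induction S using Finset.induction_on with
    | empty => simp
    | insert s S _ ih =>
      have heq : {z | ∀ s' ∈ insert s S, (∃ z', D s' z' ≠ 0) → D s' z ≠ 0} =
          {z | (∃ z', D s z' ≠ 0) → D s z ≠ 0} ∩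
            {z | ∀ s ∈ S, (∃ z', D s z' ≠ 0) → D s z ≠ 0} := by
        ext z
        simp only [Finset.mem_insert, forall_eq_or_imp, mem_ofPred_eq, mem_inter_iff]
      rw [heq]
      by_cases hs : ∃ z', D s z' ≠ 0
      · have h1 : {z | (∃ z', D s z' ≠ 0) → D s z ≠ 0} = {z | D s z ≠ 0} := by
          ext z
          simp [hs]
        have h2 : IsOpen {z | D s z ≠ 0} := isOpen_ne_fun (hD s) continuous_const
        rw [h1]
        obtain ⟨z', hz'⟩ := hs
        exact ⟨h2.inter ih.1, ((hp s).dense hz').inter_of_isOpen_left ih.2 h2⟩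
      · have h1 : {z | (∃ z', D s z' ≠ 0) → D s z ≠ 0} = univ := by
          ext z
          simp [hs]
        rw [h1, univ_inter]
        exact ih
  have := (key Finset.univ).2
  simpa [genericSet] using this

end Generic

lemma isOpen_genericSet {Z σ : Type*} [TopologicalSpace Z] [Finite σ] {D : σ → Z → ℝ}
    (hD : ∀ s, Continuous (D s)) :
    IsOpen (genericSet D) := by
  simp only [genericSet, ofPred_forall]
  refine isOpen_iInter_of_finite fun s => isOpen_iInter_of_finite fun _ => ?_
  exact isOpen_ne_fun (hD s) continuous_const

/-! ### The general-position conditions on the two matrices. -/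

/-- The cross product in the plane. -/
def cross (x y : Fin 2 → ℝ) : ℝ := x 0 * y 1 - x 1 * y 0

/-- The homogeneous coordinates of a point of the plane. -/
def homogeneous (p : Fin 2 → ℝ) : Fin 3 → ℝ := ![p 0, p 1, 1]

/-- The coefficients of the functional `f ↦ a ⬝ᵥ f p` on affine maps. -/
def incidenceRow (a p : Fin 2 → ℝ) : Fin 2 × Fin 3 → ℝ := fun q => a q.1 * homogeneous p q.2

variable {m n : ℕ}

/-- The augmented matrix of the seven affine equations `a_i ⬝ᵥ f p_j = 1` for `(i, j)` in the
family `S`. -/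
def incidenceMatrix (S : Option (Fin 2 × Fin 3) → Fin n × Fin m)
    (z : Matrix (Fin 2) (Fin m) ℝ × Matrix (Fin n) (Fin 2) ℝ) :
    Matrix (Option (Fin 2 × Fin 3)) (Option (Fin 2 × Fin 3)) ℝ :=
  fun k q => q.elim 1 (incidenceRow (z.2 (S k).1) fun r => z.1 r (S k).2)

/-- The polynomials whose non-vanishing is our notion of genericity. -/
def genericPolynomial :
    (Option (Fin 2 × Fin 3) → Fin n × Fin m) ⊕ (Fin m × Fin m × Fin m × Fin m) ⊕
      (Fin n × Fin n × Fin n) ⊕ (Fin n × Fin n) →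
    Matrix (Fin 2) (Fin m) ℝ × Matrix (Fin n) (Fin 2) ℝ → ℝ
  | .inl S, z => (incidenceMatrix S z).det
  | .inr (.inl (a, b, c, d)), z =>
    cross (fun r => z.1 r b - z.1 r a) (fun r => z.1 r d - z.1 r c)
  | .inr (.inr (.inl (a, b, c))), z =>
    cross (fun r => z.2 b r - z.2 a r) (fun r => z.2 c r - z.2 a r)
  | .inr (.inr (.inr (a, b))), z => cross (z.2 a) (z.2 b)

lemma polynomialOnLines_fst (r : Fin 2) (j : Fin m) :
    PolynomialOnLines fun z : Matrix (Fin 2) (Fin m) ℝ × Matrix (Fin n) (Fin 2) ℝ => z.1 r j :=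
  PolynomialOnLines.linear (Z := Matrix (Fin 2) (Fin m) ℝ × Matrix (Fin n) (Fin 2) ℝ)
    { toFun := fun z => z.1 r j, map_add' := fun _ _ => rfl, map_smul' := fun _ _ => rfl }

lemma polynomialOnLines_snd (i : Fin n) (r : Fin 2) :
    PolynomialOnLines fun z : Matrix (Fin 2) (Fin m) ℝ × Matrix (Fin n) (Fin 2) ℝ => z.2 i r :=
  PolynomialOnLines.linear (Z := Matrix (Fin 2) (Fin m) ℝ × Matrix (Fin n) (Fin 2) ℝ)
    { toFun := fun z => z.2 i r, map_add' := fun _ _ => rfl, map_smul' := fun _ _ => rfl }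

lemma continuous_fst_entry (r : Fin 2) (j : Fin m) :
    Continuous fun z : Matrix (Fin 2) (Fin m) ℝ × Matrix (Fin n) (Fin 2) ℝ => z.1 r j :=
  continuous_fst.matrix_elem r j

lemma continuous_snd_entry (i : Fin n) (r : Fin 2) :
    Continuous fun z : Matrix (Fin 2) (Fin m) ℝ × Matrix (Fin n) (Fin 2) ℝ => z.2 i r :=
  continuous_snd.matrix_elem i r

lemma polynomialOnLines_genericPolynomial (s) :
    PolynomialOnLines (genericPolynomial (m := m) (n := n) s) := by
  have h1 := polynomialOnLines_fst (m := m) (n := n)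
  have h2 := polynomialOnLines_snd (m := m) (n := n)
  rcases s with S | ⟨a, b, c, d⟩ | ⟨a, b, c⟩ | ⟨a, b⟩
  · refine PolynomialOnLines.det fun k q => ?_
    rcases q with _ | ⟨r, c⟩
    · exact .const 1
    · refine (h2 _ _).mul ?_
      fin_cases c
      · exact h1 _ _
      · exact h1 _ _
      · exact .const 1
  · exact (((h1 _ _).sub (h1 _ _)).mul ((h1 _ _).sub (h1 _ _))).sub
      (((h1 _ _).sub (h1 _ _)).mul ((h1 _ _).sub (h1 _ _)))
  · exact (((h2 _ _).sub (h2 _ _)).mul ((h2 _ _).sub (h2 _ _))).sub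
      (((h2 _ _).sub (h2 _ _)).mul ((h2 _ _).sub (h2 _ _)))
  · exact ((h2 _ _).mul (h2 _ _)).sub ((h2 _ _).mul (h2 _ _))

lemma continuous_genericPolynomial (s) : Continuous (genericPolynomial (m := m) (n := n) s) := by
  have h1 := continuous_fst_entry (m := m) (n := n)
  have h2 := continuous_snd_entry (m := m) (n := n)
  rcases s with S | ⟨a, b, c, d⟩ | ⟨a, b, c⟩ | ⟨a, b⟩
  · refine Continuous.matrix_det (continuous_matrix fun k q => ?_)
    rcases q with _ | ⟨r, c⟩
    · exact continuous_const
    · refine (h2 _ _).mul ?_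
      fin_cases c
      · exact h1 _ _
      · exact h1 _ _
      · exact continuous_const
  · exact (((h1 _ _).sub (h1 _ _)).mul ((h1 _ _).sub (h1 _ _))).sub
      (((h1 _ _).sub (h1 _ _)).mul ((h1 _ _).sub (h1 _ _)))
  · exact (((h2 _ _).sub (h2 _ _)).mul ((h2 _ _).sub (h2 _ _))).sub
      (((h2 _ _).sub (h2 _ _)).mul ((h2 _ _).sub (h2 _ _)))
  · exact ((h2 _ _).mul (h2 _ _)).sub ((h2 _ _).mul (h2 _ _))

/-- No two of the lines through two columns of `z.1` are parallel, and no three columns are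
collinear. -/
lemma cross_columns_ne_zero {z : Matrix (Fin 2) (Fin m) ℝ × Matrix (Fin n) (Fin 2) ℝ}
    (hz : z ∈ genericSet genericPolynomial) {a b c d : Fin m} (hab : a ≠ b) (hcd : d ≠ c)
    (hda : d ≠ a) (hdb : d ≠ b) :
    cross (fun r => z.1 r b - z.1 r a) (fun r => z.1 r d - z.1 r c) ≠ 0 := by
  -- With `x` the indicator of column `b` and `y` that of column `d`, the cross product is 1.
  -- Allowing `c = a` covers collinearity.
  refine hz (.inr (.inl (a, b, c, d)))
    ⟨(fun r j => if r = 0 then (if j = b then 1 else 0) else (if j = d then 1 else 0), 0), ?_⟩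
  simp [genericPolynomial, cross, hab, hcd.symm, hdb, hda.symm, hdb.symm]

lemma cross_rows_sub_ne_zero {z : Matrix (Fin 2) (Fin m) ℝ × Matrix (Fin n) (Fin 2) ℝ}
    (hz : z ∈ genericSet genericPolynomial) {a b c : Fin n} (hab : a ≠ b) (hac : a ≠ c)
    (hbc : b ≠ c) : cross (fun r => z.2 b r - z.2 a r) (fun r => z.2 c r - z.2 a r) ≠ 0 := by
  refine hz (.inr (.inr (.inl (a, b, c))))
    ⟨(0, fun j r => if r = 0 then (if j = b then 1 else 0) else (if j = c then 1 else 0)), ?_⟩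
  simp [genericPolynomial, cross, hab, hac, hbc, hbc.symm]

lemma cross_rows_ne_zero {z : Matrix (Fin 2) (Fin m) ℝ × Matrix (Fin n) (Fin 2) ℝ}
    (hz : z ∈ genericSet genericPolynomial) {a b : Fin n} (hab : a ≠ b) :
    cross (z.2 a) (z.2 b) ≠ 0 := by
  refine hz (.inr (.inr (.inr (a, b))))
    ⟨(0, fun j r => if r = 0 then (if j = a then 1 else 0) else (if j = b then 1 else 0)), ?_⟩
  simp [genericPolynomial, cross, hab, hab.symm]

/-! ### Openness of the realization conditions. -/

/-- The linear functional given by a row of a matrix. -/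
def rowForm (M' : Matrix (Fin n) (Fin 2) ℝ) (i : Fin n) : (Fin 2 → ℝ) →ₗ[ℝ] ℝ :=
  LinearMap.proj i ∘ₗ M'.mulVecLin

lemma rowForm_apply (M' : Matrix (Fin n) (Fin 2) ℝ) (i : Fin n) (x : Fin 2 → ℝ) :
    rowForm M' i x = M' i 0 * x 0 + M' i 1 * x 1 := by
  simp [rowForm, Matrix.mulVec, dotProduct, Fin.sum_univ_two]

lemma rowPolyhedron_eq (M' : Matrix (Fin n) (Fin 2) ℝ) :
    rowPolyhedron M' = polyhedron (rowForm M') fun _ => 1 := rfl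

lemma rowForm_zero_lt (M' : Matrix (Fin n) (Fin 2) ℝ) (i : Fin n) : rowForm M' i 0 < 1 := by
  simp

lemma isClosed_rowPolyhedron (M' : Matrix (Fin n) (Fin 2) ℝ) : IsClosed (rowPolyhedron M') := by
  rw [rowPolyhedron_eq, polyhedron, Set.ofPred_forall]
  refine isClosed_iInter fun i => isClosed_le ?_ continuous_const
  exact LinearMap.continuous_of_finiteDimensional _

/-- A facet witness may be rescaled, so the equation `rowForm M' i x = 1` gives way to strict
inequalities, which are open in `M'`. -/
lemma mem_rowRealizations_iff {M' : Matrix (Fin n) (Fin 2) ℝ} :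
    M' ∈ rowRealizations 2 n ↔ Bornology.IsBounded (rowPolyhedron M') ∧
      ∀ i, ∃ x, 0 < rowForm M' i x ∧ ∀ k, k ≠ i → rowForm M' k x < rowForm M' i x := by
  have h₀ := rowForm_zero_lt M'
  constructor
  · rintro ⟨hc, -, hf⟩
    refine ⟨hc.isBounded, fun i => ?_⟩
    rw [rowPolyhedron_eq] at hf
    obtain ⟨x, hx, hx'⟩ := exists_witness_of_encard_facets h₀ (by simpa using hf) i
    exact ⟨x, by rw [hx]; norm_num, fun k hk => by rw [hx]; exact hx' k hk⟩
  · rintro ⟨hb, hw⟩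
    refine ⟨Metric.isCompact_of_isClosed_isBounded (isClosed_rowPolyhedron M') hb, ?_, ?_⟩
    · rw [rowPolyhedron_eq, dim_polyhedron h₀]
      simp
    · rw [rowPolyhedron_eq, encard_facets_of_witness h₀]
      · simp
      · intro i
        obtain ⟨x, hx, hx'⟩ := hw i
        refine ⟨(rowForm M' i x)⁻¹ • x, ?_, fun k hk => ?_⟩
        · rw [map_smul, smul_eq_mul, inv_mul_cancel₀ hx.ne']
        · rw [map_smul, smul_eq_mul, inv_mul_eq_div, div_lt_one hx]
          exact hx' k hk

/-- Let `Q(M')` lie in the ball of radius `ρ`. A far point of a nearby `Q(M'')` shrinks to some `y`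
of norm `3 * ρ`; changing back to `M'` costs at most `1 / 2` per coordinate, so `y / 2` lies in
`Q(M')` with norm `3 * ρ / 2`. -/
lemma isOpen_setOf_isBounded_rowPolyhedron :
    IsOpen {M' : Matrix (Fin n) (Fin 2) ℝ | Bornology.IsBounded (rowPolyhedron M')} := by
  rw [isOpen_iff_mem_nhds]
  intro M' (hM' : Bornology.IsBounded (rowPolyhedron M'))
  obtain ⟨ρ, hρ, hsub⟩ := hM'.subset_closedBall_lt 0 0
  have hev : ∀ᶠ M'' in nhds M', ∀ i r, |M'' i r - M' i r| < 1 / (6 * ρ) := by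
    rw [Filter.eventually_all]
    intro i
    rw [Filter.eventually_all]
    intro r
    have hc : Continuous fun M'' : Matrix (Fin n) (Fin 2) ℝ => |M'' i r - M' i r| :=
      ((continuous_id.matrix_elem i r).sub continuous_const).abs
    have := hc.tendsto M'
    rw [sub_self, abs_zero] at this
    exact this.eventually_lt_const (by positivity)
  filter_upwards [hev] with M'' hM''
  refine (Metric.isBounded_closedBall (x := (0 : Fin 2 → ℝ)) (r := 3 * ρ)).subset fun x hx => ?_
  rw [mem_closedBall_zero_iff]
  by_contra! hlt
  have hxpos : 0 < ‖x‖ := by linarith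
  set y : Fin 2 → ℝ := (3 * ρ / ‖x‖) • x with hy
  have hs1 : 3 * ρ / ‖x‖ ≤ 1 := by
    rw [div_le_one hxpos]
    exact hlt.le
  have hs0 : 0 ≤ 3 * ρ / ‖x‖ := by positivity
  have hynorm : ‖y‖ = 3 * ρ := by
    rw [hy, norm_smul, Real.norm_of_nonneg hs0, div_mul_cancel₀ _ hxpos.ne']
  have hyQ : (1 / 2 : ℝ) • y ∈ rowPolyhedron M' := by
    intro i
    change rowForm M' i _ ≤ 1
    have h1 : rowForm M'' i y ≤ 1 := by
      have h2 : rowForm M'' i x ≤ 1 := hx i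
      rw [hy, map_smul, smul_eq_mul]
      nlinarith
    have hbd : ∀ r, (M' i r - M'' i r) * y r ≤ 1 / 2 := by
      intro r
      have h3 : |y r| ≤ 3 * ρ := hynorm ▸ norm_le_pi_norm y r
      have h4 := hM'' i r
      calc (M' i r - M'' i r) * y r ≤ |(M' i r - M'' i r) * y r| := le_abs_self _
        _ = |M'' i r - M' i r| * |y r| := by rw [abs_mul, abs_sub_comm]
        _ ≤ 1 / (6 * ρ) * (3 * ρ) := by gcongr
        _ = 1 / 2 := by field_simp; norm_num
    have h5 := hbd 0
    have h6 := hbd 1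
    rw [map_smul, smul_eq_mul]
    rw [rowForm_apply] at h1 ⊢
    linarith
  have := hsub hyQ
  rw [mem_closedBall_zero_iff, norm_smul, hynorm, Real.norm_of_nonneg (by norm_num)] at this
  linarith

lemma isOpen_rowRealizations : IsOpen (rowRealizations 2 n) := by
  have heq : rowRealizations 2 n = {M' | Bornology.IsBounded (rowPolyhedron M')} ∩
      {M' | ∀ i, ∃ x, 0 < rowForm M' i x ∧ ∀ k, k ≠ i → rowForm M' k x < rowForm M' i x} := by
    ext M'
    exact mem_rowRealizations_iff
  have hc : ∀ i x, Continuous fun M' : Matrix (Fin n) (Fin 2) ℝ => rowForm M' i x := by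
    intro i x
    simp only [rowForm_apply]
    exact ((continuous_id.matrix_elem i 0).mul continuous_const).add
      ((continuous_id.matrix_elem i 1).mul continuous_const)
  rw [heq]
  refine isOpen_setOf_isBounded_rowPolyhedron.inter ?_
  simp only [Set.ofPred_forall, Set.ofPred_exists, Set.ofPred_and]
  refine isOpen_iInter_of_finite fun i => isOpen_iUnion fun x =>
    (isOpen_lt continuous_const (hc i x)).inter (isOpen_iInter_of_finite fun k =>
      isOpen_iInter_of_finite fun _ => isOpen_lt (hc k x) (hc i x))

/-- Separating each column strictly from the hull of the others turns convex position into an open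
condition. -/
lemma convexIndependent_iff_exists {M : Matrix (Fin 2) (Fin m) ℝ} :
    ConvexIndependent ℝ (fun (j : Fin m) (i : Fin 2) => M i j) ↔
      ∀ j, ∃ c : Fin 2 → ℝ, ∀ k, k ≠ j →
        c 0 * M 0 j + c 1 * M 1 j < c 0 * M 0 k + c 1 * M 1 k := by
  rw [convexIndependent_iff_notMem_convexHull_sdiff]
  constructor
  · intro h j
    set C := convexHull ℝ ((fun (j : Fin m) (i : Fin 2) => M i j) '' (univ \ {j})) with hC
    have hcl : IsClosed C :=
      (((Set.toFinite _).image _).isCompact_convexHull ℝ).isClosed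
    obtain ⟨f, u, hu, hf⟩ := geometric_hahn_banach_point_closed (convex_convexHull ℝ _) hcl
      (h j univ)
    have hexp : ∀ x : Fin 2 → ℝ, f x = f (Pi.single 0 1) * x 0 + f (Pi.single 1 1) * x 1 := by
      intro x
      have : x = x 0 • Pi.single 0 1 + x 1 • Pi.single 1 1 := by
        ext r
        fin_cases r <;> simp
      conv_lhs => rw [this]
      simp only [map_add, map_smul, smul_eq_mul]
      ring
    refine ⟨fun r => f (Pi.single r 1), fun k hk => ?_⟩
    have h1 := hf (fun i => M i k) (subset_convexHull ℝ _ ⟨k, by simpa using hk, rfl⟩)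
    have h2 := hu.trans h1
    rwa [hexp, hexp (fun i => M i k)] at h2
  · intro h j s hmem
    obtain ⟨c, hc⟩ := h j
    let g : (Fin 2 → ℝ) →ₗ[ℝ] ℝ := c 0 • LinearMap.proj 0 + c 1 • LinearMap.proj 1
    have hsub : convexHull ℝ ((fun (j : Fin m) (i : Fin 2) => M i j) '' (s \ {j})) ⊆
        {x | g (fun i => M i j) < g x} := by
      refine convexHull_min ?_ (convex_halfSpace_gt g.isLinear _)
      rintro _ ⟨k, hk, rfl⟩
      simpa [g] using hc k hk.2
    have hlt : g (fun i => M i j) < g (fun i => M i j) := hsub hmem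
    exact lt_irrefl _ hlt

lemma isOpen_setOf_convexIndependent :
    IsOpen {M : Matrix (Fin 2) (Fin m) ℝ |
      ConvexIndependent ℝ (fun (j : Fin m) (i : Fin 2) => M i j)} := by
  simp only [convexIndependent_iff_exists, Set.ofPred_forall, Set.ofPred_exists]
  refine isOpen_iInter_of_finite fun j => isOpen_iUnion fun c => isOpen_iInter_of_finite fun k =>
    isOpen_iInter_of_finite fun _ => ?_
  have h := fun r k => continuous_id.matrix_elem (X := Matrix (Fin 2) (Fin m) ℝ) (R := ℝ) r k
  exact isOpen_lt ((continuous_const.mul (h 0 j)).add (continuous_const.mul (h 1 j)))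
    ((continuous_const.mul (h 0 k)).add (continuous_const.mul (h 1 k)))

/-- The indices of the inequalities `M' x ≤ 1` that are tight at `x`. -/
def tightRows (M' : Matrix (Fin n) (Fin 2) ℝ) (x : Fin 2 → ℝ) : Set (Fin n) :=
  {i | rowForm M' i x = 1}

lemma mem_tightRows {M' : Matrix (Fin n) (Fin 2) ℝ} {x : Fin 2 → ℝ} {i : Fin n} :
    i ∈ tightRows M' x ↔ rowForm M' i x = 1 := Iff.rfl

variable {z : Matrix (Fin 2) (Fin m) ℝ × Matrix (Fin n) (Fin 2) ℝ}

/-! ### Counting vertices and edge lines of the polygon `Q`. -/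

section Polygon

lemma eq_zero_of_cross_ne_zero {x y v : Fin 2 → ℝ} (h : cross x y ≠ 0)
    (hx : x 0 * v 0 + x 1 * v 1 = 0) (hy : y 0 * v 0 + y 1 * v 1 = 0) : v = 0 := by
  unfold cross at h
  ext r
  fin_cases r
  · refine (mul_eq_zero.1 (?_ : (x 0 * y 1 - x 1 * y 0) * v 0 = 0)).resolve_left h
    linear_combination y 1 * hx - x 1 * hy
  · refine (mul_eq_zero.1 (?_ : (x 0 * y 1 - x 1 * y 0) * v 1 = 0)).resolve_left h
    linear_combination x 0 * hy - y 0 * hx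

/-- The differences of three tight rows are orthogonal to `x` and span the plane, forcing `x = 0`,
which lies on no line `a_i ⬝ᵥ x = 1`. -/
lemma ncard_tightRows_le_two (hz : z ∈ genericSet genericPolynomial) (x : Fin 2 → ℝ) :
    (tightRows z.2 x).ncard ≤ 2 := by
  by_contra! h
  obtain ⟨a, ha, b, hb, c, hc, hab, hac, hbc⟩ := (Set.two_lt_ncard (Set.toFinite _)).1 h
  have hx := eq_zero_of_cross_ne_zero (v := x) (cross_rows_sub_ne_zero hz hab hac hbc)
  rw [mem_tightRows] at ha hb hc
  have hx0 : x = 0 := by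
    rw [rowForm_apply] at ha hb hc
    exact hx (by linarith) (by linarith)
  rw [hx0] at ha
  simp at ha

lemma ncard_tightRows_of_mem_vertices (hz : z ∈ genericSet genericPolynomial) {u : Fin 2 → ℝ}
    (hu : u ∈ vertices (rowPolyhedron z.2)) : (tightRows z.2 u).ncard = 2 := by
  refine le_antisymm (ncard_tightRows_le_two hz u) ?_
  rw [rowPolyhedron_eq] at hu
  have := finrank_le_ncard_tight hu
  rwa [Module.finrank_fin_fun] at this

lemma mem_vertices_of_two_tight (hz : z ∈ genericSet genericPolynomial) {u : Fin 2 → ℝ}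
    (hu : u ∈ rowPolyhedron z.2) {i i' : Fin n} (hne : i ≠ i') (hi : i ∈ tightRows z.2 u)
    (hi' : i' ∈ tightRows z.2 u) : u ∈ vertices (rowPolyhedron z.2) := by
  rw [rowPolyhedron_eq] at hu ⊢
  refine mem_extremePoints_polyhedron.2 ⟨hu, fun v hv => ?_⟩
  refine eq_zero_of_cross_ne_zero (cross_rows_ne_zero hz hne) ?_ ?_
  · rw [← rowForm_apply]
    exact hv i hi
  · rw [← rowForm_apply]
    exact hv i' hi'

/-- `cross (M' i)` serves as a coordinate along line `i`, used to order the points on it. -/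
lemma eq_of_mem_tightRows {M' : Matrix (Fin n) (Fin 2) ℝ} {i : Fin n} {x y : Fin 2 → ℝ}
    (hx : i ∈ tightRows M' x) (hy : i ∈ tightRows M' y)
    (h : cross (M' i) x = cross (M' i) y) : x = y := by
  rw [mem_tightRows, rowForm_apply] at hx hy
  unfold cross at h
  have hpos : M' i 0 ^ 2 + M' i 1 ^ 2 ≠ 0 := by
    intro h0
    have h1 : M' i 0 = 0 := by nlinarith [sq_nonneg (M' i 0), sq_nonneg (M' i 1)]
    have h2 : M' i 1 = 0 := by nlinarith [sq_nonneg (M' i 0), sq_nonneg (M' i 1)]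
    rw [h1, h2] at hx
    norm_num at hx
  ext r
  fin_cases r
  · apply mul_left_cancel₀ hpos
    simp only [Fin.zero_eta]
    linear_combination M' i 0 * (hx - hy) - M' i 1 * h
  · apply mul_left_cancel₀ hpos
    simp only [Fin.mk_one]
    linear_combination M' i 1 * (hx - hy) + M' i 0 * h

lemma not_between_of_mem_vertices {M' : Matrix (Fin n) (Fin 2) ℝ} {i : Fin n}
    {x y w : Fin 2 → ℝ} (hx : x ∈ rowPolyhedron M') (hw : w ∈ rowPolyhedron M')
    (hy : y ∈ vertices (rowPolyhedron M')) (hxi : i ∈ tightRows M' x) (hyi : i ∈ tightRows M' y)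
    (hwi : i ∈ tightRows M' w) (hxy : cross (M' i) x < cross (M' i) y)
    (hyw : cross (M' i) y < cross (M' i) w) : False := by
  set kx := cross (M' i) x
  set ky := cross (M' i) y
  set kw := cross (M' i) w
  have hpos : 0 < kw - kx := by linarith
  have hsum : (kw - ky) / (kw - kx) + (ky - kx) / (kw - kx) = 1 := by
    field_simp
    ring
  have hmem : y ∈ openSegment ℝ x w := by
    refine ⟨(kw - ky) / (kw - kx), (ky - kx) / (kw - kx), div_pos (by linarith) hpos,
      div_pos (by linarith) hpos, hsum, ?_⟩
    refine eq_of_mem_tightRows (i := i) (M' := M') ?_ hyi ?_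
    · rw [mem_tightRows] at hxi hwi ⊢
      rw [map_add, map_smul, map_smul, hxi, hwi, smul_eq_mul, smul_eq_mul, mul_one, mul_one, hsum]
    · have hlin : ∀ s t : ℝ, cross (M' i) (s • x + t • w) = s * kx + t * kw := by
        intro s t
        simp only [kx, kw, cross, Pi.add_apply, Pi.smul_apply, smul_eq_mul]
        ring
      rw [hlin]
      change _ = ky
      field_simp
      ring
  have := hy.2 hx hw hmem
  exact hxy.ne (congrArg (cross (M' i)) this)

lemma ncard_vertices_on_line_le_two {M' : Matrix (Fin n) (Fin 2) ℝ} (i : Fin n) :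
    {u ∈ vertices (rowPolyhedron M') | i ∈ tightRows M' u}.ncard ≤ 2 := by
  by_contra! h
  obtain ⟨x, ⟨hx, hxi⟩, y, ⟨hy, hyi⟩, w, ⟨hw, hwi⟩, hxy, hxw, hyw⟩ :=
    (Set.two_lt_ncard (Set.finite_of_ncard_pos (by omega))).1 h
  have h1 : cross (M' i) x ≠ cross (M' i) y := fun h => hxy (eq_of_mem_tightRows hxi hyi h)
  have h2 : cross (M' i) x ≠ cross (M' i) w := fun h => hxw (eq_of_mem_tightRows hxi hwi h)
  have h3 : cross (M' i) y ≠ cross (M' i) w := fun h => hyw (eq_of_mem_tightRows hyi hwi h)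
  rcases h1.lt_or_gt with h1 | h1 <;> rcases h2.lt_or_gt with h2 | h2 <;>
    rcases h3.lt_or_gt with h3 | h3
  · exact not_between_of_mem_vertices hx.1 hw.1 hy hxi hyi hwi h1 h3
  · exact not_between_of_mem_vertices hx.1 hy.1 hw hxi hwi hyi h2 h3
  · linarith
  · exact not_between_of_mem_vertices hw.1 hy.1 hx hwi hxi hyi h2 h1
  · exact not_between_of_mem_vertices hy.1 hw.1 hx hyi hxi hwi h1 h2
  · linarith
  · exact not_between_of_mem_vertices hy.1 hx.1 hw hyi hwi hxi h3 h2
  · exact not_between_of_mem_vertices hw.1 hx.1 hy hwi hyi hxi h3 h1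

lemma finite_vertices_rowPolyhedron (M' : Matrix (Fin n) (Fin 2) ℝ) :
    (vertices (rowPolyhedron M')).Finite :=
  finite_extremePoints_polyhedron (l := rowForm M') (b := fun _ => 1)

/-- The tight face is compact and nonempty, so it has an extreme point, which is extreme in `Q` as
well. -/
lemma exists_vertex_on_line {M' : Matrix (Fin n) (Fin 2) ℝ} (hM' : M' ∈ rowRealizations 2 n)
    (i : Fin n) : ∃ u ∈ vertices (rowPolyhedron M'), i ∈ tightRows M' u := by
  set F := tightFace (rowForm M') (fun _ => 1) i with hF
  have hne : F.Nonempty := by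
    obtain ⟨x, hx, hx'⟩ := exists_witness_of_encard_facets (rowForm_zero_lt M')
      (by simpa [rowPolyhedron_eq] using hM'.2.2) i
    refine ⟨x, fun k => ?_, hx⟩
    by_cases hk : k = i
    · rw [hk, hx]
    · exact (hx' k hk).le
  have hcomp : IsCompact F := by
    have hcl : IsClosed {x | rowForm M' i x = 1} :=
      isClosed_eq (LinearMap.continuous_of_finiteDimensional _) continuous_const
    exact hM'.1.inter_right hcl
  obtain ⟨u, hu⟩ := hcomp.extremePoints_nonempty hne
  refine ⟨u, ⟨hu.1.1, ?_⟩, hu.1.2⟩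
  intro y hy w hw hseg
  have hui : rowForm M' i u = 1 := hu.1.2
  have hyi : rowForm M' i y ≤ 1 := hy i
  have hwi : rowForm M' i w ≤ 1 := hw i
  have hseg' := hseg
  obtain ⟨s, t, hs, ht, hst, rfl⟩ := hseg
  rw [map_add, map_smul, map_smul, smul_eq_mul, smul_eq_mul] at hui
  have h1 : rowForm M' i y = 1 := by nlinarith
  have h2 : rowForm M' i w = 1 := by nlinarith
  exact hu.2 ⟨hy, h1⟩ ⟨hw, h2⟩ hseg'

/-- Double counting: every line carries a vertex, and a vertex lies on at most two lines. -/
lemma le_two_mul_ncard_vertices (hz : z ∈ genericSet genericPolynomial)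
    (hM' : z.2 ∈ rowRealizations 2 n) : n ≤ 2 * (vertices (rowPolyhedron z.2)).ncard := by
  classical
  have hfin := finite_vertices_rowPolyhedron z.2
  have hcover : (Finset.univ : Finset (Fin n)) ⊆
      hfin.toFinset.biUnion fun u => (tightRows z.2 u).toFinset := by
    intro i _
    obtain ⟨u, hu, hui⟩ := exists_vertex_on_line hM' i
    simp only [Finset.mem_biUnion, Set.mem_toFinset, Set.Finite.mem_toFinset]
    exact ⟨u, hu, hui⟩
  have h1 := Finset.card_le_card hcover
  have h2 := Finset.card_biUnion_le_card_mul hfin.toFinset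
    (fun u => (tightRows z.2 u).toFinset) 2 fun u _ => by
      rw [← Set.ncard_eq_toFinset_card']
      exact ncard_tightRows_le_two hz u
  rw [Finset.card_univ, Fintype.card_fin] at h1
  rw [Set.ncard_eq_toFinset_card _ hfin]
  omega

/-- The pairs of vertices of a polygon that do not lie on a common edge. -/
def disjointPairs (M' : Matrix (Fin n) (Fin 2) ℝ) : Set ((Fin 2 → ℝ) × (Fin 2 → ℝ)) :=
  {q | q.1 ∈ vertices (rowPolyhedron M') ∧ q.2 ∈ vertices (rowPolyhedron M') ∧
    Disjoint (tightRows M' q.1) (tightRows M' q.2)}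

/-- A vertex lies on at most two lines, each with at most two vertices, so at most four vertices
(itself included) share a line with it. -/
lemma sq_ncard_vertices_le (hz : z ∈ genericSet genericPolynomial) :
    (vertices (rowPolyhedron z.2)).ncard * (vertices (rowPolyhedron z.2)).ncard ≤
      (disjointPairs z.2).ncard + 4 * (vertices (rowPolyhedron z.2)).ncard := by
  classical
  have hfin := finite_vertices_rowPolyhedron z.2
  set W := hfin.toFinset with hW
  have hcard : (vertices (rowPolyhedron z.2)).ncard = W.card := Set.ncard_eq_toFinset_card _ hfin
  have hmemW : ∀ u, u ∈ W ↔ u ∈ vertices (rowPolyhedron z.2) := fun u => hfin.mem_toFinset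
  have hpairs : disjointPairs z.2 = ((W ×ˢ W).filter fun q =>
      Disjoint (tightRows z.2 q.1) (tightRows z.2 q.2) : Finset _) := by
    ext q
    simp only [disjointPairs, Finset.coe_filter, Finset.mem_product, hmemW, mem_ofPred_eq,
      and_assoc]
  have hbad : ((W ×ˢ W).filter fun q =>
      ¬ Disjoint (tightRows z.2 q.1) (tightRows z.2 q.2)).card ≤ W.card * 4 := by
    have hsub : ((W ×ˢ W).filter fun q =>
        ¬ Disjoint (tightRows z.2 q.1) (tightRows z.2 q.2)) ⊆
        W.biUnion fun u => (tightRows z.2 u).toFinset.biUnion fun i =>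
          (W.filter fun w => i ∈ tightRows z.2 w).image fun w => (u, w) := by
      rintro ⟨u, w⟩ hq
      simp only [Finset.mem_filter, Finset.mem_product, Set.not_disjoint_iff] at hq
      obtain ⟨⟨hu, hw⟩, i, hiu, hiw⟩ := hq
      simp only [Finset.mem_biUnion, Finset.mem_image, Finset.mem_filter, Set.mem_toFinset]
      exact ⟨u, hu, i, hiu, w, ⟨hw, hiw⟩, rfl⟩
    refine (Finset.card_le_card hsub).trans (Finset.card_biUnion_le_card_mul _ _ _ fun u _ => ?_)
    have h2 : (tightRows z.2 u).toFinset.card ≤ 2 := by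
      rw [← Set.ncard_eq_toFinset_card']
      exact ncard_tightRows_le_two hz u
    refine (Finset.card_biUnion_le_card_mul _ _ 2 fun i _ => ?_).trans
      (by omega : _ ≤ 4)
    refine Finset.card_image_le.trans ?_
    have := ncard_vertices_on_line_le_two (M' := z.2) i
    have heq : {u ∈ vertices (rowPolyhedron z.2) | i ∈ tightRows z.2 u} =
        (W.filter fun w => i ∈ tightRows z.2 w : Finset _) := by
      ext q
      simp only [Finset.coe_filter, hmemW, mem_ofPred_eq]
    rwa [heq, Set.ncard_coe_finset] at this
  have htot := Finset.card_filter_add_card_filter_not (s := W ×ˢ W)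
    (fun q => Disjoint (tightRows z.2 q.1) (tightRows z.2 q.2))
  rw [Finset.card_product] at htot
  rw [hpairs, Set.ncard_coe_finset, hcard]
  omega

end Polygon

/-! ### The hom-polytope as a polyhedron in dimension six. -/

section Hom

/-- The affine maps of the plane. -/
abbrev PlaneMap : Type := (Fin 2 → ℝ) →ᵃ[ℝ] (Fin 2 → ℝ)

lemma finrank_planeMap : Module.finrank ℝ PlaneMap = 6 := by
  simp [PlaneMap, AffineMap.finrank_eq]

/-- The `j`-th column of a matrix. -/
def column (M : Matrix (Fin 2) (Fin m) ℝ) (j : Fin m) : Fin 2 → ℝ := fun r => M r j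

/-- The functional `f ↦ a_i ⬝ᵥ f p_j` on affine maps. -/
def homForm (M : Matrix (Fin 2) (Fin m) ℝ) (M' : Matrix (Fin n) (Fin 2) ℝ) (e : Fin n × Fin m) :
    PlaneMap →ₗ[ℝ] ℝ where
  toFun f := rowForm M' e.1 (f (column M e.2))
  map_add' f g := by simp
  map_smul' c f := by simp

lemma homForm_apply (M : Matrix (Fin 2) (Fin m) ℝ) (M' : Matrix (Fin n) (Fin 2) ℝ)
    (e : Fin n × Fin m) (f : PlaneMap) :
    homForm M M' e f = rowForm M' e.1 (f (column M e.2)) := rfl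

lemma homForm_zero_lt (M : Matrix (Fin 2) (Fin m) ℝ) (M' : Matrix (Fin n) (Fin 2) ℝ)
    (e : Fin n × Fin m) : homForm M M' e 0 < 1 := by
  simp

lemma homPolytope_eq (M : Matrix (Fin 2) (Fin m) ℝ) (M' : Matrix (Fin n) (Fin 2) ℝ) :
    homPolytope (colPolytope M) (rowPolyhedron M') = polyhedron (homForm M M') fun _ => 1 := by
  ext f
  constructor
  · intro hf e
    exact hf (subset_convexHull ℝ _ ⟨e.2, rfl⟩) e.1
  · intro hf
    have hsub : colPolytope M ⊆ f ⁻¹' rowPolyhedron M' := by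
      refine convexHull_min ?_ ?_
      · rintro _ ⟨j, rfl⟩ i
        exact hf (i, j)
      · rw [rowPolyhedron_eq]
        exact convex_polyhedron.affine_preimage f
    exact hsub

lemma mem_rowPolyhedron_of_mem {M : Matrix (Fin 2) (Fin m) ℝ} {M' : Matrix (Fin n) (Fin 2) ℝ}
    {f : PlaneMap} (hf : f ∈ polyhedron (homForm M M') fun _ => 1) (j : Fin m) :
    f (column M j) ∈ rowPolyhedron M' :=
  fun i => hf (i, j)

/-- The pairs `(i, j)` for which `f` maps the column `j` into the line `i`. -/
def tightPairs (M : Matrix (Fin 2) (Fin m) ℝ) (M' : Matrix (Fin n) (Fin 2) ℝ) (f : PlaneMap) :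
    Set (Fin n × Fin m) :=
  {e | homForm M M' e f = 1}

lemma mem_tightPairs {M : Matrix (Fin 2) (Fin m) ℝ} {M' : Matrix (Fin n) (Fin 2) ℝ}
    {f : PlaneMap} {e : Fin n × Fin m} :
    e ∈ tightPairs M M' f ↔ e.1 ∈ tightRows M' (f (column M e.2)) := Iff.rfl

lemma seven_le_ncard_tightPairs {M : Matrix (Fin 2) (Fin m) ℝ} {M' : Matrix (Fin n) (Fin 2) ℝ}
    {f : PlaneMap} (hf : f ∈ vertices (polyhedron (homForm M M') fun _ => 1))
    (hns : f ∉ simpleVertices (polyhedron (homForm M M') fun _ => 1)) :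
    7 ≤ (tightPairs M M' f).ncard := by
  have h1 : 6 ≤ (tightPairs M M' f).ncard := by
    have := finrank_le_ncard_tight hf
    rwa [finrank_planeMap] at this
  have h2 : (tightPairs M M' f).ncard ≠ 6 := by
    intro h
    refine hns (mem_simpleVertices_of_ncard (homForm_zero_lt M M') hf ?_)
    rw [finrank_planeMap]
    exact h
  omega

end Hom

/-! ### Quadratically many simple vertices, of rank one. -/

section SimpleVertices

lemma cross_eq_zero_of_linear {G₀ G₁ : ℝ} (hG : G₀ ≠ 0 ∨ G₁ ≠ 0) {x y : Fin 2 → ℝ}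
    (hx : G₀ * x 0 + G₁ * x 1 = 0) (hy : G₀ * y 0 + G₁ * y 1 = 0) : cross x y = 0 := by
  unfold cross
  rcases hG with h | h
  · refine (mul_eq_zero.1 (?_ : G₀ * (x 0 * y 1 - x 1 * y 0) = 0)).resolve_left h
    linear_combination y 1 * hx - x 1 * hy
  · refine (mul_eq_zero.1 (?_ : G₁ * (x 0 * y 1 - x 1 * y 0) = 0)).resolve_left h
    linear_combination x 0 * hy - y 0 * hx

lemma exists_fin_ne_ne (hm : 3 ≤ m) (a b : Fin m) : ∃ c, c ≠ a ∧ c ≠ b := by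
  have h : ({a, b} : Finset (Fin m)).card < (Finset.univ : Finset (Fin m)).card := by
    rw [Finset.card_univ, Fintype.card_fin]
    exact (Finset.card_le_two).trans_lt (by omega)
  obtain ⟨c, -, hc⟩ := Finset.exists_mem_notMem_of_card_lt_card h
  simp only [Finset.mem_insert, Finset.mem_singleton, not_or] at hc
  exact ⟨c, hc⟩

/-- A polygon in general position has an edge and a vertex that is the only one farthest from
this edge. -/
lemma exists_edge_and_farthest_vertex (hm : 3 ≤ m) (hz : z ∈ genericSet genericPolynomial)
    (hconv : ConvexIndependent ℝ (fun (j : Fin m) (i : Fin 2) => z.1 i j)) :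
    ∃ (a b c : Fin m) (g : (Fin 2 → ℝ) →ᵃ[ℝ] ℝ), a ≠ b ∧ c ≠ a ∧ c ≠ b ∧
      g (column z.1 a) = 0 ∧ g (column z.1 b) = 0 ∧ g (column z.1 c) = 1 ∧
      ∀ j, j ≠ a → j ≠ b → j ≠ c → 0 < g (column z.1 j) ∧ g (column z.1 j) < 1 := by
  classical
  have hpos : 0 < m := by omega
  let a : Fin m := ⟨0, hpos⟩
  obtain ⟨q, hq⟩ := convexIndependent_iff_exists.1 hconv a
  let L : Fin m → ℝ := fun j => q 0 * (z.1 0 j - z.1 0 a) + q 1 * (z.1 1 j - z.1 1 a)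
  let k : Fin m → ℝ := fun j => -q 1 * (z.1 0 j - z.1 0 a) + q 0 * (z.1 1 j - z.1 1 a)
  have hL : ∀ j, j ≠ a → 0 < L j := by
    intro j hj
    have := hq j hj
    simp only [L]
    linarith
  obtain ⟨d, hda, -⟩ := exists_fin_ne_ne hm a a
  -- Gift wrapping: all other columns satisfy `L > 0`, so the one of extreme slope `k / L` seen from
  -- `a` spans an edge with `a`.
  obtain ⟨b, hb, hbmax⟩ := Finset.exists_max_image (Finset.univ.erase a) (fun j => k j / L j)
    ⟨d, by simpa using hda⟩
  have hba : b ≠ a := Finset.ne_of_mem_erase hb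
  set r := k b / L b with hr
  have hrb : r * L b = k b := div_mul_cancel₀ _ (hL b hba).ne'
  let G₀ : ℝ := r * q 0 + q 1
  let G₁ : ℝ := r * q 1 - q 0
  have hGL : ∀ j, G₀ * (z.1 0 j - z.1 0 a) + G₁ * (z.1 1 j - z.1 1 a) = r * L j - k j := by
    intro j
    simp only [G₀, G₁, L, k]
    ring
  have hG : G₀ ≠ 0 ∨ G₁ ≠ 0 := by
    by_contra! hcon
    have h0 : r * q 0 + q 1 = 0 := hcon.1
    have h1 : r * q 1 - q 0 = 0 := hcon.2
    have h2 : q 0 = 0 := by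
      refine (mul_eq_zero.1 (?_ : (1 + r ^ 2) * q 0 = 0)).resolve_left (by positivity)
      linear_combination r * h0 - h1
    have h3 : q 1 = 0 := by
      rw [h2] at h0
      linarith
    have := hL d hda
    simp [L, h2, h3] at this
  let H : Fin m → ℝ := fun j => G₀ * (z.1 0 j - z.1 0 a) + G₁ * (z.1 1 j - z.1 1 a)
  have hHa : H a = 0 := by simp [H]
  have hHb : H b = 0 := by
    simp only [H]
    rw [hGL, hrb, sub_self]
  have hH : ∀ j, j ≠ a → j ≠ b → 0 < H j := by
    intro j hja hjb
    have h0 : 0 ≤ H j := by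
      simp only [H]
      rw [hGL, sub_nonneg, ← div_le_iff₀ (hL j hja)]
      exact hbmax j (by simpa using hja)
    refine h0.lt_of_ne fun h => ?_
    exact cross_columns_ne_zero hz (a := a) (b := b) (c := a) (d := j) hba.symm hja hja hjb
      (cross_eq_zero_of_linear hG hHb h.symm)
  obtain ⟨c, -, hcmax⟩ := Finset.exists_max_image Finset.univ H ⟨a, Finset.mem_univ a⟩
  obtain ⟨e, hea, heb⟩ := exists_fin_ne_ne hm a b
  have hHc : 0 < H c := (hH e hea heb).trans_le (hcmax e (Finset.mem_univ e))
  have hca : c ≠ a := by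
    rintro h
    rw [h, hHa] at hHc
    exact lt_irrefl _ hHc
  have hcb : c ≠ b := by
    rintro h
    rw [h, hHb] at hHc
    exact lt_irrefl _ hHc
  let G : (Fin 2 → ℝ) →ₗ[ℝ] ℝ := G₀ • LinearMap.proj 0 + G₁ • LinearMap.proj 1
  let g : (Fin 2 → ℝ) →ᵃ[ℝ] ℝ :=
    ((H c)⁻¹ • G).toAffineMap - AffineMap.const ℝ _ ((H c)⁻¹ * G (column z.1 a))
  have hg : ∀ j, g (column z.1 j) = H j / H c := by
    intro j
    have : g (column z.1 j) = (H c)⁻¹ * G (column z.1 j) - (H c)⁻¹ * G (column z.1 a) := rfl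
    rw [this]
    simp only [G, H, column, LinearMap.add_apply, LinearMap.smul_apply, LinearMap.proj_apply,
      smul_eq_mul]
    ring
  refine ⟨a, b, c, g, hba.symm, hca, hcb, ?_, ?_, ?_, fun j hja hjb hjc => ⟨?_, ?_⟩⟩
  · rw [hg, hHa, zero_div]
  · rw [hg, hHb, zero_div]
  · rw [hg, div_self hHc.ne']
  · rw [hg]
    exact div_pos (hH j hja hjb) hHc
  · rw [hg, div_lt_one hHc]
    -- A second farthest column would make the chord from `c` to `j` parallel to the edge `a b`.
    refine (hcmax j (Finset.mem_univ j)).lt_of_ne fun h => ?_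
    refine cross_columns_ne_zero hz (a := a) (b := b) (c := c) (d := j) hba.symm hjc hja hjb
      (cross_eq_zero_of_linear hG hHb ?_)
    simp only [H] at h
    linarith

lemma rowForm_lineMap (M' : Matrix (Fin n) (Fin 2) ℝ) (i : Fin n) (u w : Fin 2 → ℝ) (s : ℝ) :
    rowForm M' i (AffineMap.lineMap u w s) = (1 - s) * rowForm M' i u + s * rowForm M' i w := by
  rw [AffineMap.lineMap_apply_module, map_add, map_smul, map_smul, smul_eq_mul, smul_eq_mul]

lemma lineMap_mem_rowPolyhedron {M' : Matrix (Fin n) (Fin 2) ℝ} {u w : Fin 2 → ℝ}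
    (hu : u ∈ rowPolyhedron M') (hw : w ∈ rowPolyhedron M') {s : ℝ} (h0 : 0 ≤ s) (h1 : s ≤ 1) :
    AffineMap.lineMap u w s ∈ rowPolyhedron M' := by
  rw [AffineMap.lineMap_apply_module]
  exact convex_polyhedron (l := rowForm M') hu hw (by linarith) h0 (by ring)

/-- A line that is tight in the interior of a segment in the polygon is tight at its ends. -/
lemma mem_tightRows_of_lineMap {M' : Matrix (Fin n) (Fin 2) ℝ} {u w : Fin 2 → ℝ}
    (hu : u ∈ rowPolyhedron M') (hw : w ∈ rowPolyhedron M') {s : ℝ} (h0 : 0 < s) (h1 : s < 1)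
    {i : Fin n} (hi : i ∈ tightRows M' (AffineMap.lineMap u w s)) :
    i ∈ tightRows M' u ∧ i ∈ tightRows M' w := by
  rw [mem_tightRows, rowForm_lineMap] at hi
  have hui : rowForm M' i u ≤ 1 := hu i
  have hwi : rowForm M' i w ≤ 1 := hw i
  constructor
  · rw [mem_tightRows]
    nlinarith
  · rw [mem_tightRows]
    nlinarith

lemma cross_smul (x y v : Fin 2 → ℝ) : cross x y • v = cross v y • x + cross x v • y := by
  ext k
  simp only [cross, Pi.smul_apply, Pi.add_apply, smul_eq_mul]
  fin_cases k
  · simp only [Fin.zero_eta]; ring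
  · simp only [Fin.mk_one]; ring

lemma planeMap_eq_zero {f : PlaneMap} {p q r : Fin 2 → ℝ} (h : cross (q - p) (r - p) ≠ 0)
    (hp : f p = 0) (hq : f q = 0) (hr : f r = 0) : f = 0 := by
  have hlin : ∀ x, f.linear (x - p) = f x := by
    intro x
    have := f.linearMap_vsub x p
    simpa [hp] using this
  have h1 := hlin q
  have h2 := hlin r
  have hL : ∀ v, f.linear v = 0 := by
    intro v
    have h3 := congrArg f.linear (cross_smul (q - p) (r - p) v)
    rw [map_smul, map_add, map_smul, map_smul, h1, h2, hq, hr] at h3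
    simpa [h] using h3
  refine AffineMap.ext fun x => ?_
  rw [← hlin, hL]
  rfl

/-- The pair `(u, w)` gives the map sending `a, b` to `u`, `c` to `w` and all other columns strictly
between, where no line is tight because `u` and `w` share none. The pair is recovered from the
images of `a` and `c`. -/
lemma ncard_disjointPairs_le (hm : 3 ≤ m) (hz : z ∈ genericSet genericPolynomial)
    (hconv : ConvexIndependent ℝ (fun (j : Fin m) (i : Fin 2) => z.1 i j)) :
    (disjointPairs z.2).ncard ≤
      (simpleVertices (polyhedron (homForm z.1 z.2) fun _ => 1)).ncard := by
  obtain ⟨a, b, c, g, hab, hca, hcb, hga, hgb, hgc, hg⟩ :=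
    exists_edge_and_farthest_vertex hm hz hconv
  let F : (Fin 2 → ℝ) × (Fin 2 → ℝ) → PlaneMap := fun q => (AffineMap.lineMap q.1 q.2).comp g
  have hF : ∀ q x, F q x = AffineMap.lineMap q.1 q.2 (g x) := fun _ _ => rfl
  have hFa : ∀ q, F q (column z.1 a) = q.1 := fun q => by
    rw [hF, hga, AffineMap.lineMap_apply_zero]
  have hFb : ∀ q, F q (column z.1 b) = q.1 := fun q => by
    rw [hF, hgb, AffineMap.lineMap_apply_zero]
  have hFc : ∀ q, F q (column z.1 c) = q.2 := fun q => by
    rw [hF, hgc, AffineMap.lineMap_apply_one]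
  refine Set.ncard_le_ncard_of_injOn F ?_ ?_
    ((finite_extremePoints_polyhedron (l := homForm z.1 z.2) (b := fun _ => 1)).subset
      fun f hf => hf.1)
  · rintro ⟨u, w⟩ ⟨hu, hw, hdisj⟩
    have huw : ∀ i, i ∈ tightRows z.2 u → i ∈ tightRows z.2 w → False :=
      fun i h1 h2 => Set.disjoint_left.1 hdisj h1 h2
    have hrange : ∀ j, 0 ≤ g (column z.1 j) ∧ g (column z.1 j) ≤ 1 := by
      intro j
      by_cases hja : j = a
      · rw [hja, hga]; norm_num
      by_cases hjb : j = b
      · rw [hjb, hgb]; norm_num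
      by_cases hjc : j = c
      · rw [hjc, hgc]; norm_num
      exact ⟨(hg j hja hjb hjc).1.le, (hg j hja hjb hjc).2.le⟩
    have hmem : F (u, w) ∈ polyhedron (homForm z.1 z.2) fun _ => 1 := by
      rintro ⟨i, j⟩
      exact lineMap_mem_rowPolyhedron hu.1 hw.1 (hrange j).1 (hrange j).2 i
    have hsepu := (mem_extremePoints_polyhedron (l := rowForm z.2) (b := fun _ => 1)).1 hu
    have hsepw := (mem_extremePoints_polyhedron (l := rowForm z.2) (b := fun _ => 1)).1 hw
    have hvert : F (u, w) ∈ vertices (polyhedron (homForm z.1 z.2) fun _ => 1) := by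
      refine mem_extremePoints_polyhedron.2 ⟨hmem, fun v hv => ?_⟩
      -- The lines tight at `u` and `w` force `v` to vanish at three non-collinear columns.
      refine planeMap_eq_zero (cross_columns_ne_zero hz (a := a) (b := b) (c := a) (d := c) hab
        hca hca hcb) (hsepu.2 _ fun i hi => hv (i, a) ?_) (hsepu.2 _ fun i hi => hv (i, b) ?_)
        (hsepw.2 _ fun i hi => hv (i, c) ?_)
      · rw [homForm_apply, hFa]; exact hi
      · rw [homForm_apply, hFb]; exact hi
      · rw [homForm_apply, hFc]; exact hi
    refine mem_simpleVertices_of_ncard (homForm_zero_lt z.1 z.2) hvert ?_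
    have hT : {e | homForm z.1 z.2 e (F (u, w)) = 1} =
        tightRows z.2 u ×ˢ {a, b} ∪ tightRows z.2 w ×ˢ {c} := by
      ext ⟨i, j⟩
      simp only [mem_union, mem_prod, mem_insert_iff, mem_singleton_iff]
      change i ∈ tightRows z.2 (F (u, w) (column z.1 j)) ↔ _
      by_cases hja : j = a
      · rw [hja, hFa]
        simp [hca.symm]
      by_cases hjb : j = b
      · rw [hjb, hFb]
        simp [hcb.symm]
      by_cases hjc : j = c
      · rw [hjc, hFc]
        simp [hca, hcb]
      simp only [hja, hjb, hjc, or_self, and_false, iff_false]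
      intro hi
      obtain ⟨h1, h2⟩ := mem_tightRows_of_lineMap hu.1 hw.1 (hg j hja hjb hjc).1
        (hg j hja hjb hjc).2 hi
      exact huw i h1 h2
    rw [hT, finrank_planeMap, Set.ncard_union_eq, Set.ncard_prod, Set.ncard_prod,
      Set.ncard_pair hab, Set.ncard_singleton, ncard_tightRows_of_mem_vertices hz hu,
      ncard_tightRows_of_mem_vertices hz hw]
    rw [Set.disjoint_left]
    rintro ⟨i, j⟩ ⟨h1, -⟩ ⟨h2, -⟩
    exact huw i h1 h2
  · intro q _ q' _ h
    have h1 := congrArg (fun f : PlaneMap => f (column z.1 a)) h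
    have h2 := congrArg (fun f : PlaneMap => f (column z.1 c)) h
    simp only [hFa, hFc] at h1 h2
    exact Prod.ext h1 h2

end SimpleVertices

/-! ### Vertices of rank at most one that are not simple. -/

section CollapsedVertices

/-- There are few vertices of the hom-polytope that map the polygon into an edge. -/
lemma ncard_vertices_into_line_le (hz : z ∈ genericSet genericPolynomial) :
    {f ∈ vertices (polyhedron (homForm z.1 z.2) fun _ => 1) |
      ∃ i, ∀ j, (i, j) ∈ tightPairs z.1 z.2 f}.ncard ≤ n * 3 ^ m := by
  classical
  have hfin := finite_vertices_rowPolyhedron z.2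
  -- The possible tight sets at a point of `Q` on line `i`: `{i}` alone, or that of one of the at
  -- most two vertices on it.
  let D : Fin n → Finset (Set (Fin n)) := fun i =>
    insert {i} ((hfin.toFinset.filter fun u => i ∈ tightRows z.2 u).image (tightRows z.2))
  have hD : ∀ i, (D i).card ≤ 3 := by
    intro i
    refine (Finset.card_insert_le _ _).trans (Nat.succ_le_succ (Finset.card_image_le.trans ?_))
    have := ncard_vertices_on_line_le_two (M' := z.2) i
    have heq : {u ∈ vertices (rowPolyhedron z.2) | i ∈ tightRows z.2 u} =
        (hfin.toFinset.filter fun w => i ∈ tightRows z.2 w : Finset _) := by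
      ext q
      simp only [Finset.coe_filter, Set.Finite.mem_toFinset, mem_ofPred_eq]
    rwa [heq, Set.ncard_coe_finset] at this
  let B : Finset (Fin m → Set (Fin n)) :=
    Finset.univ.biUnion fun i => Fintype.piFinset fun _ : Fin m => D i
  have hB : B.card ≤ n * 3 ^ m := by
    refine (Finset.card_biUnion_le_card_mul _ _ (3 ^ m) fun i _ => ?_).trans (by simp)
    rw [Fintype.card_piFinset]
    simpa using Nat.pow_le_pow_left (hD i) m
  refine le_trans ?_ hB
  rw [← Set.ncard_coe_finset]
  refine Set.ncard_le_ncard_of_injOn (fun f j => tightRows z.2 (f (column z.1 j))) ?_ ?_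
    (Finset.finite_toSet _)
  · rintro f ⟨hf, i, hi⟩
    simp only [B, Finset.mem_coe, Finset.mem_biUnion, Fintype.mem_piFinset]
    refine ⟨i, Finset.mem_univ i, fun j => ?_⟩
    have hij : i ∈ tightRows z.2 (f (column z.1 j)) := hi j
    by_cases h : ∃ i', i ≠ i' ∧ i' ∈ tightRows z.2 (f (column z.1 j))
    · obtain ⟨i', hne, hi'⟩ := h
      refine Finset.mem_insert_of_mem (Finset.mem_image_of_mem _ ?_)
      simp only [Finset.mem_filter, Set.Finite.mem_toFinset]
      exact ⟨mem_vertices_of_two_tight hz (mem_rowPolyhedron_of_mem hf.1 j) hne hij hi', hij⟩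
    · push Not at h
      have : tightRows z.2 (f (column z.1 j)) = {i} := by
        ext i'
        constructor
        · intro hi'
          by_contra hne
          exact h i' (fun h => hne h.symm) hi'
        · rintro rfl
          exact hij
      rw [this]
      exact Finset.mem_insert_self _ _
  · rintro f ⟨hf, -⟩ f' ⟨hf', -⟩ h
    have key : ∀ e, homForm z.1 z.2 e f = 1 → homForm z.1 z.2 e f' = 1 := by
      rintro ⟨i, j⟩ he
      have h1 : i ∈ tightRows z.2 (f (column z.1 j)) := he
      have h2 := congrFun h j
      simp only at h2
      rw [h2] at h1
      exact h1
    have := (mem_extremePoints_polyhedron.1 hf).2 (f - f') fun e he => by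
      rw [map_sub, he, key e he, sub_self]
    exact sub_eq_zero.1 this

/-- A map of rank at most one with at least seven tight pairs maps the polygon into an edge. -/
lemma exists_line_of_not_injective (hm : 3 ≤ m) (hz : z ∈ genericSet genericPolynomial)
    {f : PlaneMap} (hf : f ∈ polyhedron (homForm z.1 z.2) fun _ => 1)
    (hcard : 7 ≤ (tightPairs z.1 z.2 f).ncard) {v : Fin 2 → ℝ} (hv : v ≠ 0)
    (hfv : f.linear v = 0) : ∃ i, ∀ j, (i, j) ∈ tightPairs z.1 z.2 f := by
  classical
  -- `φ` is the coordinate transverse to `v`. Since `f` is constant along `v`, the image of a column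
  -- depends only on its `φ`.
  let φ : Fin m → ℝ := fun j => cross v (column z.1 j)
  have hv' : -v 1 ≠ 0 ∨ v 0 ≠ 0 := by
    by_contra! h
    apply hv
    ext r
    fin_cases r
    · exact h.2
    · simpa using h.1
  have hφ : ∀ j j', φ j = φ j' ↔ -v 1 * (z.1 0 j - z.1 0 j') + v 0 * (z.1 1 j - z.1 1 j') = 0 := by
    intro j j'
    simp only [φ, cross, column]
    constructor <;> intro h <;> linarith
  have hne : (Finset.univ : Finset (Fin m)).Nonempty := ⟨⟨0, by omega⟩, Finset.mem_univ _⟩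
  obtain ⟨p, -, hp⟩ := Finset.exists_min_image Finset.univ φ hne
  obtain ⟨q, -, hq⟩ := Finset.exists_max_image Finset.univ φ hne
  have hpar : ∀ a b c d : Fin m, a ≠ b → d ≠ c → d ≠ a → d ≠ b → φ b = φ a → φ d = φ c → False :=
    fun a b c d h1 h2 h3 h4 h5 h6 => cross_columns_ne_zero hz h1 h2 h3 h4
      (cross_eq_zero_of_linear hv' ((hφ _ _).1 h5) ((hφ _ _).1 h6))
  have hpq : φ p < φ q := by
    refine (hp q (Finset.mem_univ q)).lt_of_ne fun h => ?_
    have hall : ∀ j, φ j = φ p := fun j =>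
      le_antisymm (h ▸ hq j (Finset.mem_univ j)) (hp j (Finset.mem_univ j))
    obtain ⟨b, hb, -⟩ := exists_fin_ne_ne hm p p
    obtain ⟨d, hd, hd'⟩ := exists_fin_ne_ne hm p b
    exact hpar p b p d hb.symm hd hd hd' (hall b) (hall d)
  set u := f (column z.1 p) with hu
  set w := f (column z.1 q) with hw
  have hmem : ∀ j, f (column z.1 j) ∈ rowPolyhedron z.2 := mem_rowPolyhedron_of_mem hf
  have hpos : 0 < φ q - φ p := by linarith
  have hseg : ∀ j, f (column z.1 j) = AffineMap.lineMap u w ((φ j - φ p) / (φ q - φ p)) := by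
    intro j
    set s := (φ j - φ p) / (φ q - φ p) with hs
    have hs' : s * (φ q - φ p) = φ j - φ p := div_mul_cancel₀ _ hpos.ne'
    rw [hu, hw, ← AffineMap.apply_lineMap]
    set y := AffineMap.lineMap (column z.1 p) (column z.1 q) s with hy
    have hyr : ∀ r, y r = (1 - s) * z.1 r p + s * z.1 r q := by
      intro r
      simp [hy, AffineMap.lineMap_apply_module, column]
    have hker : f.linear (column z.1 j - y) = 0 := by
      have hnorm : v 0 ^ 2 + v 1 ^ 2 ≠ 0 := by
        rcases hv' with h | h
        · have : v 1 ≠ 0 := fun h' => h (by simp [h'])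
          positivity
        · positivity
      have hcr : cross v (column z.1 j - y) = 0 := by
        simp only [cross, Pi.sub_apply, hyr, column]
        simp only [φ, cross, column] at hs'
        linarith
      have hmul : (v 0 ^ 2 + v 1 ^ 2) • (column z.1 j - y) =
          (v 0 * (column z.1 j - y) 0 + v 1 * (column z.1 j - y) 1) • v := by
        unfold cross at hcr
        ext r
        simp only [Pi.smul_apply, smul_eq_mul]
        fin_cases r
        · simp only [Fin.zero_eta]
          linear_combination -v 1 * hcr
        · simp only [Fin.mk_one]
          linear_combination v 0 * hcr
      have := congrArg f.linear hmul
      rw [map_smul, map_smul, hfv, smul_zero] at this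
      exact (smul_eq_zero.1 this).resolve_left hnorm
    have := f.linearMap_vsub (column z.1 j) y
    rw [vsub_eq_sub, vsub_eq_sub, hker] at this
    exact (sub_eq_zero.1 this.symm)
  by_cases hex : ∃ i, i ∈ tightRows z.2 u ∧ i ∈ tightRows z.2 w
  · obtain ⟨i, hi, hi'⟩ := hex
    refine ⟨i, fun j => ?_⟩
    rw [mem_tightPairs, mem_tightRows, hseg, rowForm_lineMap, mem_tightRows.1 hi,
      mem_tightRows.1 hi']
    ring
  · exfalso
    let A : Finset (Fin m) := Finset.univ.filter fun j => φ j = φ p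
    let C : Finset (Fin m) := Finset.univ.filter fun j => φ j = φ q
    have hA : ∀ j, j ∈ A ↔ φ j = φ p := by simp [A]
    have hC : ∀ j, j ∈ C ↔ φ j = φ q := by simp [C]
    -- No three columns are collinear and no two disjoint chords are parallel, so the extreme levels
    -- of `φ` hold at most `2 + 1` columns. Only these can be tight, each on at most two lines: six
    -- pairs, not seven.
    have hAC : (A ∪ C).card ≤ 3 := by
      by_contra! hcon
      have hle := Finset.card_union_le A C
      have htwo : ∀ S : Finset (Fin m), (∀ j ∈ S, ∀ j' ∈ S, φ j = φ j') → S.card ≤ 2 := by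
        intro S hS
        by_contra! h3
        obtain ⟨a, ha, b, hb, c, hc, hab, hac, hbc⟩ := Finset.two_lt_card.1 h3
        exact hpar a b a c hab hac.symm hac.symm hbc.symm (hS b hb a ha) (hS c hc a ha)
      have hA2 := htwo A fun j hj j' hj' => ((hA j).1 hj).trans ((hA j').1 hj').symm
      have hC2 := htwo C fun j hj j' hj' => ((hC j).1 hj).trans ((hC j').1 hj').symm
      obtain ⟨a, ha, b, hb, hab⟩ := Finset.one_lt_card.1 (by omega : 1 < A.card)
      obtain ⟨c, hc, d, hd, hcd⟩ := Finset.one_lt_card.1 (by omega : 1 < C.card)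
      rw [hA] at ha hb
      rw [hC] at hc hd
      refine hpar a b c d hab hcd.symm ?_ ?_ (hb.trans ha.symm) (hd.trans hc.symm)
      · rintro rfl
        exact hpq.ne (ha.symm.trans hd)
      · rintro rfl
        exact hpq.ne (hb.symm.trans hd)
    have hsub : (tightPairs z.1 z.2 f).toFinset ⊆ (A ∪ C).biUnion fun j =>
        (tightRows z.2 (f (column z.1 j))).toFinset.image fun i => (i, j) := by
      rintro ⟨i, j⟩ he
      rw [Set.mem_toFinset] at he
      have hij : i ∈ tightRows z.2 (f (column z.1 j)) := he
      simp only [Finset.mem_biUnion, Finset.mem_image, Set.mem_toFinset]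
      refine ⟨j, ?_, i, hij, rfl⟩
      by_contra hj
      rw [Finset.mem_union, hA, hC, not_or] at hj
      have h1 : φ p < φ j := (hp j (Finset.mem_univ j)).lt_of_ne (Ne.symm hj.1)
      have h2 : φ j < φ q := (hq j (Finset.mem_univ j)).lt_of_ne hj.2
      rw [hseg] at hij
      exact hex ⟨i, mem_tightRows_of_lineMap (hmem p) (hmem q) (div_pos (by linarith) hpos)
        ((div_lt_one hpos).2 (by linarith)) hij⟩
    have h1 := Finset.card_le_card hsub
    have h2 := Finset.card_biUnion_le_card_mul (A ∪ C) (fun j =>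
        (tightRows z.2 (f (column z.1 j))).toFinset.image fun i => (i, j)) 2 fun j _ => by
      refine Finset.card_image_le.trans ?_
      rw [← Set.ncard_eq_toFinset_card']
      exact ncard_tightRows_le_two hz _
    rw [← Set.ncard_eq_toFinset_card'] at h1
    omega

end CollapsedVertices

/-! ### Injective vertices have no seventh tight pair. -/

section Perturbation

/-- The affine map with a given `2 × 3` matrix in homogeneous coordinates. -/
def ofCoeff (A : Fin 2 × Fin 3 → ℝ) : PlaneMap :=
  (Matrix.mulVecLin (Matrix.of fun r c : Fin 2 => A (r, c.castSucc))).toAffineMap +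
    AffineMap.const ℝ _ fun r => A (r, 2)

lemma ofCoeff_apply (A : Fin 2 × Fin 3 → ℝ) (p : Fin 2 → ℝ) (r : Fin 2) :
    ofCoeff A p r = A (r, 0) * p 0 + A (r, 1) * p 1 + A (r, 2) := by
  simp only [ofCoeff]
  fin_cases r <;> simp

lemma incidenceRow_dotProduct (M' : Matrix (Fin n) (Fin 2) ℝ) (i : Fin n) (p : Fin 2 → ℝ)
    (A : Fin 2 × Fin 3 → ℝ) :
    incidenceRow (M' i) p ⬝ᵥ A = rowForm M' i (ofCoeff A p) := by
  rw [rowForm_apply, ofCoeff_apply, ofCoeff_apply]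
  simp only [dotProduct, incidenceRow, homogeneous, Fintype.sum_prod_type, Fin.sum_univ_two,
    Fin.sum_univ_three, Matrix.cons_val_zero, Matrix.cons_val_one, Matrix.cons_val]
  ring

lemma eq_zero_of_ofCoeff_eq_zero {A : Fin 2 × Fin 3 → ℝ} (h : ofCoeff A = 0) : A = 0 := by
  have key : ∀ (p : Fin 2 → ℝ) r, A (r, 0) * p 0 + A (r, 1) * p 1 + A (r, 2) = 0 := by
    intro p r
    rw [← ofCoeff_apply, h]
    rfl
  ext ⟨r, c⟩
  have h0 := key ![0, 0] r
  have h1 := key ![1, 0] r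
  have h2 := key ![0, 1] r
  simp only [Matrix.cons_val_zero, Matrix.cons_val_one] at h0 h1 h2
  fin_cases c
  · simp only [Fin.zero_eta, Pi.zero_apply]; linarith
  · simp only [Fin.mk_one, Pi.zero_apply]; linarith
  · simp only [Fin.reduceFinMk, Pi.zero_apply]; linarith

lemma ofCoeff_surjective : Function.Surjective ofCoeff := by
  intro f
  refine ⟨fun q => ![f.linear (Pi.single 0 1) q.1, f.linear (Pi.single 1 1) q.1, f 0 q.1] q.2, ?_⟩
  refine AffineMap.ext fun p => funext fun r => ?_
  rw [ofCoeff_apply]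
  have hp : p = p 0 • Pi.single 0 1 + p 1 • Pi.single 1 1 := by
    ext r
    fin_cases r <;> simp
  have h1 : f p = f.linear p + f 0 := by
    conv_lhs => rw [f.decomp]
    rfl
  rw [h1]
  conv_rhs => rw [hp]
  simp only [map_add, map_smul, Pi.add_apply, Pi.smul_apply, smul_eq_mul, Matrix.cons_val_zero,
    Matrix.cons_val_one, Matrix.cons_val]
  ring

/-- A family of vectors on which only the zero functional vanishes contains a basis. -/
lemma exists_det_ne_zero {T κ : Type*} [Finite T] [Fintype κ] [DecidableEq κ] (w : T → κ → ℝ)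
    (h : ∀ A, (∀ e, w e ⬝ᵥ A = 0) → A = 0) :
    ∃ B : κ → T, Function.Injective B ∧ (Matrix.of fun k => w (B k)).det ≠ 0 := by
  classical
  have := Fintype.ofFinite T
  have hrank : (Matrix.of w).rank = Fintype.card κ := by
    rw [Matrix.rank, LinearMap.finrank_range_of_inj, Module.finrank_fintype_fun_eq_card]
    rw [← LinearMap.ker_eq_bot, LinearMap.ker_eq_bot']
    intro A hA
    exact h A fun e => congrFun hA e
  obtain ⟨κ', a, ha, hspan, hli⟩ := exists_linearIndependent' ℝ w
  have := Finite.of_injective a ha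
  have := Fintype.ofFinite κ'
  have hcard : Fintype.card κ' = Fintype.card κ := by
    rw [← hrank, Matrix.rank_eq_finrank_span_row, ← finrank_span_eq_card hli, hspan]
    rfl
  let σ : κ ≃ κ' := Fintype.equivOfCardEq hcard.symm
  refine ⟨a ∘ σ, ha.comp σ.injective, ?_⟩
  have hli' : LinearIndependent ℝ (Matrix.of fun k => w ((a ∘ σ) k)).row :=
    hli.comp σ σ.injective
  rw [Matrix.linearIndependent_rows_iff_isUnit, Matrix.isUnit_iff_isUnit_det] at hli'
  exact hli'.ne_zero

/-- At most one other line passes through `x`, and it is not parallel to line `i`: move along it. If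
there is none, move along `x` itself. -/
lemma exists_transversal_direction (hz : z ∈ genericSet genericPolynomial) {x : Fin 2 → ℝ}
    {i : Fin n} (hi : i ∈ tightRows z.2 x) :
    ∃ d : Fin 2 → ℝ, rowForm z.2 i d ≠ 0 ∧
      ∀ i' ∈ tightRows z.2 x, i' ≠ i → rowForm z.2 i' d = 0 := by
  by_cases h : ∃ i' ∈ tightRows z.2 x, i' ≠ i
  · obtain ⟨k, hk, hki⟩ := h
    refine ⟨![-z.2 k 1, z.2 k 0], ?_, fun i' hi' hne => ?_⟩
    · have := cross_rows_ne_zero hz hki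
      unfold cross at this
      rw [rowForm_apply]
      simp only [Matrix.cons_val_zero, Matrix.cons_val_one]
      contrapose! this
      linarith
    · have hi'k : i' = k := by
        by_contra hik
        have h2 := ncard_tightRows_le_two hz x
        have h3 := (Set.two_lt_ncard (Set.toFinite (tightRows z.2 x))).2
          ⟨i, hi, i', hi', k, hk, hne.symm, hki.symm, hik⟩
        omega
      rw [hi'k, rowForm_apply]
      simp only [Matrix.cons_val_zero, Matrix.cons_val_one]
      ring
  · push Not at h
    exact ⟨x, by rw [mem_tightRows.1 hi]; exact one_ne_zero, fun i' hi' hne => absurd (h i' hi') hne⟩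

/-- Move the column `j` of a matrix by the vector `d`. -/
def moveColumn (M : Matrix (Fin 2) (Fin m) ℝ) (j : Fin m) (d : Fin 2 → ℝ) :
    Matrix (Fin 2) (Fin m) ℝ :=
  fun r j' => M r j' + if j' = j then d r else 0

lemma column_moveColumn_self (M : Matrix (Fin 2) (Fin m) ℝ) (j : Fin m) (d : Fin 2 → ℝ) :
    column (moveColumn M j d) j = column M j + d := by
  ext r
  simp [column, moveColumn]

lemma column_moveColumn_of_ne (M : Matrix (Fin 2) (Fin m) ℝ) {j j' : Fin m} (h : j' ≠ j)
    (d : Fin 2 → ℝ) : column (moveColumn M j d) j' = column M j' := by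
  ext r
  simp [column, moveColumn, h]

lemma incidenceMatrix_mulVec (S : Option (Fin 2 × Fin 3) → Fin n × Fin m)
    (z : Matrix (Fin 2) (Fin m) ℝ × Matrix (Fin n) (Fin 2) ℝ)
    (c : Option (Fin 2 × Fin 3) → ℝ) (k : Option (Fin 2 × Fin 3)) :
    (incidenceMatrix S z).mulVec c k =
      c none + rowForm z.2 (S k).1 (ofCoeff (fun q => c (some q)) (column z.1 (S k).2)) := by
  rw [← incidenceRow_dotProduct]
  simp [Matrix.mulVec, dotProduct, Fintype.sum_option, incidenceMatrix]
  rfl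

/-- In general position, a vertex of the hom-polytope that is an injective map has at most six
tight pairs. -/
lemma not_injective_of_seven_le (hz : z ∈ genericSet genericPolynomial) {f : PlaneMap}
    (hf : f ∈ vertices (polyhedron (homForm z.1 z.2) fun _ => 1))
    (hcard : 7 ≤ (tightPairs z.1 z.2 f).ncard) : ∃ v, v ≠ 0 ∧ f.linear v = 0 := by
  classical
  by_contra! hinj
  have hinj' : Function.Injective f.linear := by
    rw [← LinearMap.ker_eq_bot, LinearMap.ker_eq_bot']
    intro v hv
    by_contra hne
    exact hinj v hne hv
  have hsurj : Function.Surjective f.linear := LinearMap.surjective_of_injective hinj'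
  set T := tightPairs z.1 z.2 f with hT
  obtain ⟨B, hBinj, hBdet⟩ := exists_det_ne_zero
    (fun e : T => incidenceRow (z.2 e.1.1) (column z.1 e.1.2)) fun A hA => by
      refine eq_zero_of_ofCoeff_eq_zero ((mem_extremePoints_polyhedron.1 hf).2 _ fun e he => ?_)
      rw [homForm_apply, ← incidenceRow_dotProduct]
      exact hA ⟨e, he⟩
  -- Six tight pairs `B` already determine `f`; `(i, j)` is a seventh.
  obtain ⟨⟨i, j⟩, heT, heB⟩ : ∃ e ∈ T, e ∉ range fun k => (B k : Fin n × Fin m) := by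
    by_contra! hcon
    have h1 := Set.ncard_le_ncard hcon (Set.toFinite _)
    have h2 : (range fun k => (B k : Fin n × Fin m)).ncard ≤ 6 := by
      rw [← image_univ]
      refine (Set.ncard_image_le (Set.toFinite _)).trans ?_
      rw [Set.ncard_univ, Nat.card_eq_fintype_card]
      simp
    omega
  have hBe : ∀ k, (B k : Fin n × Fin m) ≠ (i, j) := fun k h => heB ⟨k, h⟩
  obtain ⟨d', hd', hd'0⟩ := exists_transversal_direction hz (x := f (column z.1 j)) (i := i) heT
  -- Injectivity of `f` enters here: moving column `j` along `d` moves its image off line `i` while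
  -- keeping the incidences in `B`.
  obtain ⟨d, rfl⟩ := hsurj d'
  let Z : ℝ → Matrix (Fin 2) (Fin m) ℝ × Matrix (Fin n) (Fin 2) ℝ := fun t =>
    (moveColumn z.1 j (t • d), z.2)
  let S : Option (Fin 2 × Fin 3) → Fin n × Fin m := fun o => o.elim (i, j) fun k => B k
  have hmove : ∀ t, f (column (Z t).1 j) = f (column z.1 j) + t • f.linear d := by
    intro t
    rw [column_moveColumn_self, add_comm, ← vadd_eq_add, f.map_vadd, map_smul, vadd_eq_add,
      add_comm]
  have hBtight : ∀ t k, rowForm z.2 (B k).1.1 (f (column (Z t).1 (B k).1.2)) = 1 := by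
    intro t k
    have hk : rowForm z.2 (B k).1.1 (f (column z.1 (B k).1.2)) = 1 := (B k).2
    by_cases hj : (B k).1.2 = j
    · rw [hj] at hk ⊢
      have hne : (B k).1.1 ≠ i := fun h => hBe k (Prod.ext h hj)
      rw [hmove, map_add, map_smul, hk, hd'0 _ hk hne, smul_zero, add_zero]
    · rw [column_moveColumn_of_ne z.1 hj]
      exact hk
  obtain ⟨t, ht0, ht⟩ : ∃ t : ℝ, t ≠ 0 ∧ (Matrix.of fun k =>
      incidenceRow (z.2 (B k).1.1) (column (Z t).1 (B k).1.2)).det ≠ 0 := by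
    have hcont : Continuous fun t : ℝ => (Matrix.of fun k =>
        incidenceRow (z.2 (B k).1.1) (column (Z t).1 (B k).1.2)).det := by
      refine Continuous.matrix_det (continuous_matrix fun k q => ?_)
      have hc : ∀ r j', Continuous fun t => column (Z t).1 j' r := by
        intro r j'
        simp only [Z, column, moveColumn]
        split_ifs
        · simp only [Pi.smul_apply]; fun_prop
        · fun_prop
      obtain ⟨r, c⟩ := q
      refine continuous_const.mul ?_
      fin_cases c
      · exact hc _ _
      · exact hc _ _
      · exact continuous_const
    have h0 : Z 0 = z := by
      refine Prod.ext ?_ rfl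
      ext r j'
      simp [Z, moveColumn]
    have hev := (hcont.tendsto 0).eventually_ne (by rw [h0]; exact hBdet)
    obtain ⟨t, ht, ht0⟩ :=
      ((hev.filter_mono nhdsWithin_le_nhds).and (self_mem_nhdsWithin (s := {(0 : ℝ)}ᶜ))).exists
    exact ⟨t, ht0, ht⟩
  obtain ⟨A, rfl⟩ := ofCoeff_surjective f
  have hadd : ∀ (c : Fin 2 × Fin 3 → ℝ) (s : ℝ) (i : Fin n) (p : Fin 2 → ℝ),
      rowForm z.2 i (ofCoeff (c + s • A) p) =
        rowForm z.2 i (ofCoeff c p) + s * rowForm z.2 i (ofCoeff A p) := by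
    intro c s i p
    simp only [← incidenceRow_dotProduct, dotProduct_add, dotProduct_smul, smul_eq_mul]
  have hdet : genericPolynomial (.inl S) (Z t) ≠ 0 := by
    intro hzero
    obtain ⟨c, hc0, hc⟩ := Matrix.exists_mulVec_eq_zero_iff.2 hzero
    have hck : ∀ k, c none +
        rowForm z.2 (S k).1 (ofCoeff (fun q => c (some q)) (column (Z t).1 (S k).2)) = 0 := by
      intro k
      have := congrFun hc k
      rwa [incidenceMatrix_mulVec] at this
    -- At `Z t` the six rows remain independent and `A` still solves their equations, so a kernel
    -- vector is a multiple of `(-1, A)`; the broken seventh equation then kills it.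
    have hh : (fun q => c (some q)) + c none • A = 0 := by
      by_contra hne
      refine ht (Matrix.exists_mulVec_eq_zero_iff.1 ⟨_, hne, funext fun k => ?_⟩)
      change incidenceRow _ _ ⬝ᵥ _ = _
      rw [incidenceRow_dotProduct, hadd, hBtight t k]
      have := hck (some k)
      simp only [S, Option.elim_some] at this
      rw [Pi.zero_apply]
      linarith
    have hnone : c none = 0 := by
      have h1 := hadd (fun q => c (some q)) (c none) i (column (Z t).1 j)
      rw [hh, ← incidenceRow_dotProduct, dotProduct_zero, hmove, map_add, map_smul,
        smul_eq_mul, show rowForm z.2 i (ofCoeff A (column z.1 j)) = 1 from heT] at h1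
      have h2 := hck none
      simp only [S, Option.elim_none] at h2
      have h3 : c none * (t * rowForm z.2 i ((ofCoeff A).linear d)) = 0 := by linarith
      exact (mul_eq_zero.1 h3).resolve_right (mul_ne_zero ht0 hd')
    apply hc0
    funext o
    rcases o with _ | q
    · exact hnone
    · rw [hnone, zero_smul, add_zero] at hh
      exact congrFun hh q
  -- The determinant is thus not identically zero, yet at `z` the solution `A` of all seven
  -- equations gives the kernel vector `(-1, A)`.
  refine hz (.inl S) ⟨Z t, hdet⟩ (Matrix.exists_mulVec_eq_zero_iff.1
    ⟨fun o => o.elim (-1) A, fun h => ?_, funext fun k => ?_⟩)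
  · have := congrFun h none
    simp at this
  · rw [incidenceMatrix_mulVec]
    have hk : rowForm z.2 (S k).1 (ofCoeff A (column z.1 (S k).2)) = 1 := by
      rcases k with _ | k
      · exact heT
      · exact (B k).2
    simp only [Option.elim_none, Option.elim_some, hk, Pi.zero_apply]
    norm_num

end Perturbation

/-! ### The open dense set and the final estimate. -/

/-- The pairs of polygons in general position. -/
def genericPairs (m n : ℕ) : Set (Matrix (Fin 2) (Fin m) ℝ × Matrix (Fin n) (Fin 2) ℝ) :=
  ({M | ConvexIndependent ℝ (fun (j : Fin m) (i : Fin 2) => M i j)} ×ˢ rowRealizations 2 n) ∩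
    genericSet genericPolynomial

lemma affineSpan_columns_eq_top (hm : 3 ≤ m) (hz : z ∈ genericSet genericPolynomial) :
    affineSpan ℝ (range fun (j : Fin m) (i : Fin 2) => z.1 i j) = ⊤ := by
  let a : Fin m := ⟨0, by omega⟩
  obtain ⟨b, hb, -⟩ := exists_fin_ne_ne hm a a
  obtain ⟨c, hca, hcb⟩ := exists_fin_ne_ne hm a b
  have hcr : cross (column z.1 b - column z.1 a) (column z.1 c - column z.1 a) ≠ 0 :=
    cross_columns_ne_zero hz hb.symm hca hca hcb
  set R := range fun (j : Fin m) (i : Fin 2) => z.1 i j with hR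
  have hmem : ∀ j, column z.1 j ∈ R := fun j => ⟨j, rfl⟩
  refine (AffineSubspace.affineSpan_eq_top_iff_vectorSpan_eq_top_of_nonempty ℝ _ _
    ⟨_, hmem a⟩).2 (eq_top_iff.2 fun v _ => ?_)
  have hx : column z.1 b - column z.1 a ∈ vectorSpan ℝ R :=
    vsub_mem_vectorSpan ℝ (hmem b) (hmem a)
  have hy : column z.1 c - column z.1 a ∈ vectorSpan ℝ R :=
    vsub_mem_vectorSpan ℝ (hmem c) (hmem a)
  rw [← Submodule.smul_mem_iff _ hcr, cross_smul]
  exact Submodule.add_mem _ (Submodule.smul_mem _ _ hx) (Submodule.smul_mem _ _ hy)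

lemma genericPairs_subset (hm : 3 ≤ m) :
    genericPairs m n ⊆ colRealizations 2 m ×ˢ rowRealizations 2 n :=
  fun _ hz => ⟨⟨hz.1.1, affineSpan_columns_eq_top hm hz.2⟩, hz.1.2⟩

lemma isOpen_genericPairs : IsOpen (genericPairs m n) :=
  (isOpen_setOf_convexIndependent.prod isOpen_rowRealizations).inter
    (isOpen_genericSet continuous_genericPolynomial)

lemma subset_closure_genericPairs :
    colRealizations 2 m ×ˢ rowRealizations 2 n ⊆ closure (genericPairs m n) := by
  have h := (dense_genericSet continuous_genericPolynomial
    (polynomialOnLines_genericPolynomial (m := m) (n := n))).open_subset_closure_inter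
    (isOpen_setOf_convexIndependent.prod isOpen_rowRealizations)
  exact fun z hz => h ⟨hz.1.1, hz.2⟩

lemma ncard_nonsimple_le (hm : 3 ≤ m) (hz : z ∈ genericSet genericPolynomial) :
    (vertices (polyhedron (homForm z.1 z.2) fun _ => 1) \
      simpleVertices (polyhedron (homForm z.1 z.2) fun _ => 1)).ncard ≤ n * 3 ^ m := by
  refine le_trans (Set.ncard_le_ncard ?_ ((finite_extremePoints_polyhedron
    (l := homForm z.1 z.2) (b := fun _ => 1)).subset fun f hf => hf.1))
    (ncard_vertices_into_line_le hz)
  rintro f ⟨hf, hns⟩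
  have hcard := seven_le_ncard_tightPairs hf hns
  obtain ⟨v, hv, hfv⟩ := not_injective_of_seven_le hz hf hcard
  exact ⟨hf, exists_line_of_not_injective hm hz hf.1 hcard hv hfv⟩

lemma sq_le_mul_ncard_simpleVertices (hm : 3 ≤ m) (hn : 16 ≤ n) (hz : z ∈ genericPairs m n) :
    n ^ 2 ≤ 8 * (simpleVertices (polyhedron (homForm z.1 z.2) fun _ => 1)).ncard := by
  have h1 := le_two_mul_ncard_vertices hz.2 hz.1.2
  have h2 := sq_ncard_vertices_le hz.2
  have h3 := ncard_disjointPairs_le hm hz.2 hz.1.1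
  -- With `v` vertices of `Q`, `v ≥ n / 2 ≥ 8`, so `v ^ 2 - 4 * v ≥ v ^ 2 / 2 ≥ n ^ 2 / 8`.
  nlinarith

lemma abs_simpleRatio_sub_one_le (hm : 3 ≤ m) (hn : 16 ≤ n) (hz : z ∈ genericPairs m n) :
    |simpleRatio (homPolytope (colPolytope z.1) (rowPolyhedron z.2)) - 1| ≤ 8 * 3 ^ m / n := by
  rw [homPolytope_eq, simpleRatio]
  set X := polyhedron (homForm z.1 z.2) fun _ => (1 : ℝ) with hX
  have hfin : (vertices X).Finite := finite_extremePoints_polyhedron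
  have h1 : ((vertices X \ simpleVertices X).ncard : ℝ) ≤ n * 3 ^ m := by
    exact_mod_cast ncard_nonsimple_le hm hz.2
  have h2 : (n : ℝ) ^ 2 ≤ 8 * (simpleVertices X).ncard := by
    exact_mod_cast sq_le_mul_ncard_simpleVertices hm hn hz
  have h3 : ((vertices X \ simpleVertices X).ncard : ℝ) + (simpleVertices X).ncard =
      (vertices X).ncard := by
    exact_mod_cast Set.ncard_sdiff_add_ncard_of_subset
      (show simpleVertices X ⊆ vertices X from fun f hf => hf.1) hfin
  have hn0 : (0 : ℝ) < n := by
    have : 0 < n := by omega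
    exact_mod_cast this
  set s : ℝ := (((simpleVertices X).ncard : ℕ) : ℝ)
  set v : ℝ := (((vertices X).ncard : ℕ) : ℝ)
  set d : ℝ := (((vertices X \ simpleVertices X).ncard : ℕ) : ℝ)
  have hd : 0 ≤ d := Nat.cast_nonneg _
  have hv : 0 < v := by nlinarith
  -- The deviation is the non-simple proportion: at most `n * 3 ^ m` over at least `n ^ 2 / 8`.
  have heq : s / v - 1 = -(d / v) := by
    rw [← h3] at hv ⊢
    field_simp
    ring
  rw [heq, abs_neg, abs_of_nonneg (div_nonneg hd hv.le), div_le_div_iff₀ hv hn0]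
  have h4 : d * n ≤ n ^ 2 * 3 ^ m := by nlinarith
  have h5 : (n : ℝ) ^ 2 ≤ 8 * v := by linarith
  have h6 : (n : ℝ) ^ 2 * 3 ^ m ≤ 8 * v * 3 ^ m := by gcongr
  linarith

end HomPolytope

theorem mainTheorem11 :
    ∃ V : (m n : ℕ) → Set (Matrix (Fin 2) (Fin m) ℝ × Matrix (Fin n) (Fin 2) ℝ),
      (∀ m n : ℕ, 3 ≤ m → 3 ≤ n →
        V m n ⊆ HomPolytope.colRealizations 2 m ×ˢ HomPolytope.rowRealizations 2 n ∧
        IsOpen (V m n) ∧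
        HomPolytope.colRealizations 2 m ×ˢ HomPolytope.rowRealizations 2 n ⊆ closure (V m n)) ∧
      ∀ m : ℕ, 3 ≤ m → ∀ ε : ℝ, 0 < ε → ∃ N : ℕ, ∀ n : ℕ, 3 ≤ n → N ≤ n →
        ∀ (M : Matrix (Fin 2) (Fin m) ℝ) (M' : Matrix (Fin n) (Fin 2) ℝ), (M, M') ∈ V m n →
          |HomPolytope.simpleRatio (HomPolytope.homPolytope (HomPolytope.colPolytope M)
            (HomPolytope.rowPolyhedron M')) - 1| < ε := by
  refine ⟨HomPolytope.genericPairs, fun m n hm _ => ⟨HomPolytope.genericPairs_subset hm,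
    HomPolytope.isOpen_genericPairs, HomPolytope.subset_closure_genericPairs⟩,
    fun m hm ε hε => ?_⟩
  obtain ⟨N, hN⟩ := exists_nat_gt (8 * 3 ^ m / ε)
  refine ⟨max N 16, fun n _ hn M M' hz => ?_⟩
  have hn16 : 16 ≤ n := (le_max_right _ _).trans hn
  have hnN : (N : ℝ) ≤ n := by exact_mod_cast (le_max_left _ _).trans hn
  have hn0 : (0 : ℝ) < n := by
    have : 0 < n := by omega
    exact_mod_cast this
  refine (HomPolytope.abs_simpleRatio_sub_one_le hm hn16 hz).trans_lt ?_
  rw [div_lt_comm₀ hn0 hε]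
  exact hN.trans_le hnN
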